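/- Setting. Consider a one-dimensional chain of $N$ coupled oscillators with masses $m_j>0$ and spring constants $k_j\ge 0$, where spring $j$ joins oscillators $j$ and $j+1$ and the last spring joins oscillators $N$ and $1$ (its constant is $0$ for an open chain). Let $B=\sqrt M^{-1}\Phi\sqrt W$, where $M=\mathrm{diag}(m_j)$, $W=\mathrm{diag}(k_j)$ and $\Phi$ is the cyclic incidence matrix with columns $e_j-e_{j+1}$. Pad $B$ with zero rows and columns to size $2^n$, $n=\lceil\log_2 N\rceil$, and let $H=-\begin{pmatrix}0&B\\B^\dagger&0\end{pmatrix}$, acting on $n+1$ signal qubits. A unitary $U$ on $a$ ancilla qubits and the signal qubits is an $(\alpha,a,\varepsilon)$-block-encoding of $A$, where $\alpha\ge0$, if $\|A-\alpha(\langle 0^a|\otimes I)U(|0^a\rangle\otimes I)\|_2\le\varepsilon$. Let $U_H$ be an $(\alpha_H,a_H,0)$-block-encoding of $H$ given as a circuit of $G_H$ elementary (at most two-qubit) gates. Circuits are built from calls of $U_H$ and $U_H^\dagger$, each possibly controlled on one work qubit and each costing $G_H$ gates, and from further gates that do not act on the signal qubits and are counted separately: one- and two-qubit gates on the work qubits,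 and (controlled) phase gates $e^{i\varphi\Pi}$, where $\Pi$ projects onto prescribed values of some work qubits and, optionally, onto $|0^{a_H}\rangle$. For a circuit $V$, let $R=I-2|0\rangle\langle 0|\otimes I$ be the reflection about the all-zero state of all ancillas. Amplifying $V$ with $m$ iterations means running $(-V'RV'^\dagger R)^mV'$, where $V'$ is $V$ together with one rotation of a fresh ancilla qubit. Let $\psi_0$ be an initial vector with $0<\|\psi_0\|_2\le1$ (a normalized state has $\|\psi_0\|_2=1$), prepared as the state $\hat\psi_0=\psi_0/\|\psi_0\|_2$, and let $\log$ be the natural logarithm. Theorem. There is an absolute constant $K$ such that for every such chain, every such $U_H$ and every $t\ge0$ the following holds. (1) Let $0<\varepsilon<1$, $\alpha_{HS}\ge4$ and $D=2\lceil 2.8\,\alpha_H t+\log(1/\varepsilon)\rceil-1$. There is a circuit $V$ that is an $(\alpha_{HS},a_H+3,\varepsilon)$-block-encoding of $e^{-iHt}$ and whose calls cost at most $D\cdot G_H$ gates, with at most $KD$ other gates. For every $\psi_0$ as above, amplifying $V$ with a suitable number $m\le\lceil\alpha_{HS}/\|\psi_0\|_2\rceil$ of iterations gives a circuit whose calls cost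 at most $$\Bigl(2\Bigl\lceil\frac{\alpha_{HS}}{\|\psi_0\|_2}\Bigr\rceil+1\Bigr)\Bigl(2\bigl\lceil 2.8\,\alpha_H t+\log(1/\varepsilon)\bigr\rceil-1\Bigr)G_H$$ gates, with at most $K\bigl(2\lceil\alpha_{HS}/\|\psi_0\|_2\rceil+1\bigr)D$ other gates, and which is an $\varepsilon$-close simulation. That is, on the input $|0\rangle\otimes\hat\psi_0$ the unnormalized signal state flagged by all ancillas being $0$ differs from $e^{-iHt}\hat\psi_0$ by at most $\varepsilon$ in norm, the probability of this flag is at least $1-\varepsilon$, and the normalized post-measurement state is also within $\varepsilon$ of $e^{-iHt}\hat\psi_0$. (2) More generally, let $V$ be any such circuit, with any number of ancillas, that is a block-encoding of $e^{-iHt}$ with any sub-normalization $\alpha_{HS}\geq 0$ and error $\delta$; let its calls cost $G_V$ gates and let it have $g$ other gates. For every $\psi_0$ as above, amplifying $V$ with a suitable number $m\le\lceil\alpha_{HS}/\|\psi_0\|_2\rceil$ of iterations gives a circuit whose calls cost at most $(2\lceil\alpha_{HS}/\|\psi_0\|_2\rceil+1)\,G_V$ gates, with at most $K(2\lceil\alpha_{HS}/\|\psi_0\|_2\rceil+1)(g+1)$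 other gates, and whose flagged output on $|0\rangle\otimes\hat\psi_0$ is within $K\delta$ of $e^{-iHt}\hat\psi_0$. -/

import Mathlib

/-! ### Quantum registers -/

/-- Computational basis states of a register whose qubits are labelled by `ι`. -/
abbrev Reg (ι : Type) : Type := ι → Fin 2

/-- State vectors (with the Euclidean norm) of a register whose qubits are labelled by `ι`. -/
abbrev QState (ι : Type) [Fintype ι] [DecidableEq ι] : Type := EuclideanSpace ℂ (Reg ι)

/-- The operator `u`, acting on qubits labelled by `κ`, applied to the qubits `f k` of a larger
register, and the identity on all its other qubits. -/
noncomputable def onQubits {ι κ : Type} [Fintype ι] [DecidableEq ι] [Fintype κ] [DecidableEq κ]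
    (f : κ ↪ ι) (u : Matrix (Reg κ) (Reg κ) ℂ) : Matrix (Reg ι) (Reg ι) ℂ :=
  Matrix.of fun x y =>
    if ∀ i, (∀ k, f k ≠ i) → x i = y i then u (fun k => x (f k)) (fun k => y (f k)) else 0

/-- The operator `u` controlled on qubit `q` (applied if the qubit is `1`). -/
noncomputable def controlledOn {ι : Type} [Fintype ι] [DecidableEq ι] (q : ι)
    (u : Matrix (Reg ι) (Reg ι) ℂ) : Matrix (Reg ι) (Reg ι) ℂ :=
  Matrix.of fun x y =>
    if x q = y q then (if x q = 1 then u x y else (1 : Matrix (Reg ι) (Reg ι) ℂ) x y) else 0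

/-- The spectral (`ℓ² → ℓ²` operator) norm of a matrix. -/
noncomputable def specNorm {ι : Type} [Fintype ι] [DecidableEq ι]
    (A : Matrix (Reg ι) (Reg ι) ℂ) : ℝ :=
  ‖Matrix.toEuclideanCLM (𝕜 := ℂ) A‖

/-! ### Block encodings: ancilla qubits `α`, signal qubits `σ` -/

/-- The block `(⟨0| ⊗ I) U (|0⟩ ⊗ I)` of an operator on ancilla and signal qubits. -/
def zeroBlock {α σ : Type} (U : Matrix (Reg (α ⊕ σ)) (Reg (α ⊕ σ)) ℂ) :
    Matrix (Reg σ) (Reg σ) ℂ :=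
  Matrix.of fun x y => U (Sum.elim (fun _ => 0) x) (Sum.elim (fun _ => 0) y)

/-- `U` is a block encoding of `A` with sub-normalization `c` and encoding error `ε`;
the ancilla qubits are those labelled by `α`. -/
structure IsBlockEncoding {α σ : Type} [Fintype α] [DecidableEq α] [Fintype σ] [DecidableEq σ]
    (c ε : ℝ) (U : Matrix (Reg (α ⊕ σ)) (Reg (α ⊕ σ)) ℂ) (A : Matrix (Reg σ) (Reg σ) ℂ) :
    Prop where
  unitary : U ∈ Matrix.unitaryGroup (Reg (α ⊕ σ)) ℂ
  nonneg : 0 ≤ c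
  error_le : specNorm (A - (c : ℂ) • zeroBlock U) ≤ ε

/-- The state `|0⟩ ⊗ ψ`. -/
noncomputable def withZeroAncilla {α σ : Type} [Fintype α] [DecidableEq α] [Fintype σ]
    [DecidableEq σ] (ψ : QState σ) : QState (α ⊕ σ) :=
  WithLp.toLp 2 fun x => if ∀ i, x (Sum.inl i) = 0 then ψ (fun j => x (Sum.inr j)) else 0

/-- The (unnormalized) signal state `(⟨0| ⊗ I) φ` that is left when the ancilla qubits are
measured to be all `0`; the squared norm is the probability of that outcome. -/
noncomputable def flagged {α σ : Type} [Fintype α] [DecidableEq α] [Fintype σ]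
    [DecidableEq σ] (φ : QState (α ⊕ σ)) : QState σ :=
  WithLp.toLp 2 fun x => φ (Sum.elim (fun _ => 0) x)

/-- The state `A ψ`. -/
noncomputable def applyOp {ι : Type} [Fintype ι] [DecidableEq ι]
    (A : Matrix (Reg ι) (Reg ι) ℂ) (ψ : QState ι) : QState ι :=
  Matrix.toEuclideanCLM (𝕜 := ℂ) A ψ

/-! ### Elementary circuits -/

/-- An elementary gate: an arbitrary unitary on at most two qubits. -/
structure LocalGate (ι : Type) where
  arity : ℕ
  arity_le : arity ≤ 2
  wires : Fin arity ↪ ι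
  op : Matrix.unitaryGroup (Reg (Fin arity)) ℂ

namespace LocalGate

noncomputable def eval {ι : Type} [Fintype ι] [DecidableEq ι] (g : LocalGate ι) :
    Matrix (Reg ι) (Reg ι) ℂ :=
  onQubits g.wires (g.op : Matrix (Reg (Fin g.arity)) (Reg (Fin g.arity)) ℂ)

/-- The inverse gate. -/
noncomputable def dagger {ι : Type} (g : LocalGate ι) : LocalGate ι :=
  { g with op := g.op⁻¹ }

/-- The same gate in a larger register. -/
def lift {ι κ : Type} (f : ι ↪ κ) (g : LocalGate ι) : LocalGate κ :=
  { g with wires := g.wires.trans f }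

end LocalGate

/-- The unitary of a list of elementary gates; the head of the list is applied first. -/
noncomputable def evalLocal {ι : Type} [Fintype ι] [DecidableEq ι] :
    List (LocalGate ι) → Matrix (Reg ι) (Reg ι) ℂ
  | [] => 1
  | g :: c => evalLocal c * g.eval

/-! ### Circuits that call a block encoding

The register consists of `b` work qubits, the `a` ancilla qubits of a given block encoding `U`,
and `s` signal qubits. The signal qubits are touched by calls of `U` and `U†` only. -/

/-- The qubits of such a circuit. -/
abbrev Wires (b a s : ℕ) : Type := (Fin b ⊕ Fin a) ⊕ Fin s

/-- The qubits on which the called block encoding acts. -/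
def callWires (b a s : ℕ) : Fin a ⊕ Fin s ↪ Wires b a s where
  toFun := Sum.map Sum.inr id
  inj' := Sum.map_injective.mpr ⟨Sum.inr_injective, Function.injective_id⟩

inductive Gate (b a : ℕ) : Type
  /-- a call of `U` (or of `U†` if `inv` is true), possibly controlled on one work qubit -/
  | call (ctrl : Option (Fin b)) (inv : Bool) : Gate b a
  /-- a one- or two-qubit gate on the work qubits -/
  | work (g : LocalGate (Fin b)) : Gate b a
  /-- a (controlled) projector-controlled phase gate: the phase `exp (i φ)` on the basis states
  in which every work qubit `q` with `p q = some v` has the value `v` and, if `z` is true, all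
  ancilla qubits of the called block encoding are `0` -/
  | phase (φ : ℝ) (p : Fin b → Option (Fin 2)) (z : Bool) : Gate b a

namespace Gate

variable {b a : ℕ}

noncomputable def eval {s : ℕ} (U : Matrix (Reg (Fin a ⊕ Fin s)) (Reg (Fin a ⊕ Fin s)) ℂ) :
    Gate b a → Matrix (Reg (Wires b a s)) (Reg (Wires b a s)) ℂ
  | call none inv => onQubits (callWires b a s) (if inv then U.conjTranspose else U)
  | call (some q) inv =>
      controlledOn (Sum.inl (Sum.inl q))
        (onQubits (callWires b a s) (if inv then U.conjTranspose else U))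
  | work g => (g.lift (Function.Embedding.inl.trans Function.Embedding.inl)).eval
  | phase φ p z => Matrix.diagonal fun x =>
      open Classical in
      if (∀ q v, p q = some v → x (Sum.inl (Sum.inl q)) = v) ∧
          (z = true → ∀ j, x (Sum.inl (Sum.inr j)) = 0)
      then Complex.exp (Complex.I * φ) else 1

/-- The inverse gate. -/
noncomputable def dagger : Gate b a → Gate b a
  | call c inv => call c (!inv)
  | work g => work g.dagger
  | phase φ p z => phase (-φ) p z

/-- The same gate in the presence of one more work qubit (the last one). -/
def lift : Gate b a → Gate (b + 1) a
  | call c inv => call (c.map Fin.castSucc) inv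
  | work g => work (g.lift Fin.castSuccEmb)
  | phase φ p z => phase φ (Fin.snoc (α := fun _ => Option (Fin 2)) p none) z

/-- Whether the gate is a call of the block encoding. -/
def isCall : Gate b a → Bool
  | call _ _ => true
  | _ => false

end Gate

/-- A circuit; the head of the list is applied first. -/
abbrev Circuit (b a : ℕ) : Type := List (Gate b a)

namespace Circuit

variable {b a : ℕ}

noncomputable def eval {s : ℕ} (U : Matrix (Reg (Fin a ⊕ Fin s)) (Reg (Fin a ⊕ Fin s)) ℂ) :
    Circuit b a → Matrix (Reg (Wires b a s)) (Reg (Wires b a s)) ℂ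
  | [] => 1
  | g :: c => eval U c * g.eval U

/-- The number of (controlled) calls of the block encoding or its inverse. -/
def calls (c : Circuit b a) : ℕ := c.countP fun g => g.isCall

/-- The number of all other gates. -/
def otherGates (c : Circuit b a) : ℕ := c.countP fun g => !g.isCall

/-- The number of gates spent in the calls, when each (controlled) call of the block encoding or
its inverse costs `G` gates. -/
def callCost (G : ℕ) (c : Circuit b a) : ℕ := c.calls * G

/-- The inverse circuit. -/
noncomputable def dagger (c : Circuit b a) : Circuit b a := (c.map Gate.dagger).reverse

/-- The rotation by the angle `θ` (that is, `R_y(2θ)`) of one qubit. -/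
noncomputable def rotation (θ : ℝ) : Matrix (Reg (Fin 1)) (Reg (Fin 1)) ℂ :=
  Matrix.of fun x y =>
    if x 0 = y 0 then (Real.cos θ : ℂ) else if x 0 = 1 then (Real.sin θ : ℂ) else -(Real.sin θ : ℂ)

theorem rotation_mem (θ : ℝ) : rotation θ ∈ Matrix.unitaryGroup (Reg (Fin 1)) ℂ := by
  rw [Matrix.mem_unitaryGroup_iff]
  ext x y
  have h : (Real.cos θ : ℂ) * Real.cos θ + (Real.sin θ : ℂ) * Real.sin θ = 1 := by
    have := Real.sin_sq_add_cos_sq θ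
    have h2 : ((Real.sin θ ^ 2 + Real.cos θ ^ 2 : ℝ) : ℂ) = 1 := by rw [this]; simp
    push_cast at h2 ⊢
    linear_combination h2
  rw [Matrix.mul_apply, ← (Equiv.funUnique (Fin 1) (Fin 2)).symm.sum_comp]
  obtain ⟨x, rfl⟩ := (Equiv.funUnique (Fin 1) (Fin 2)).symm.surjective x
  obtain ⟨y, rfl⟩ := (Equiv.funUnique (Fin 1) (Fin 2)).symm.surjective y
  rw [Fin.sum_univ_two]
  fin_cases x <;> fin_cases y <;>
    simp [rotation, Matrix.star_apply, Equiv.funUnique, -Complex.ofReal_cos,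
      -Complex.ofReal_sin, Complex.conj_ofReal, mul_comm, funext_iff] <;>
    linear_combination h

/-- The circuit `c` together with a rotation of a new work qubit. The new qubit is one more ancilla
that has to be found in `0`; the all-zero block of `c` is multiplied by `cos θ`. -/
noncomputable def damp (θ : ℝ) (c : Circuit b a) : Circuit (b + 1) a :=
  c.map Gate.lift ++
    [Gate.work ⟨1, by norm_num, ⟨fun _ => Fin.last b, fun _ _ _ => Subsingleton.elim _ _⟩,
      ⟨rotation θ, rotation_mem θ⟩⟩]

/-- The reflection `I - 2 |0⟩⟨0| ⊗ I` about the all-zero state of all ancilla qubits. -/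
noncomputable def reflection : Gate b a := Gate.phase Real.pi (fun _ => some 0) true

/-- The global phase `-1`. -/
noncomputable def negOne : Gate b a := Gate.phase Real.pi (fun _ => none) false

/-- The oblivious Grover iteration `W = - C R C† R` of the circuit `C`, where `R` is the reflection
about the all-zero ancilla state. -/
noncomputable def grover (c : Circuit b a) : Circuit b a :=
  [reflection] ++ c.dagger ++ [reflection] ++ c ++ [negOne]

/-- Oblivious amplitude amplification `W ^ m C` of the circuit `C`. -/
noncomputable def amplify (m : ℕ) (c : Circuit b a) : Circuit b a :=
  c ++ (List.replicate m (grover c)).flatten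

end Circuit

/-! ### Coupled oscillators -/

/-- A chain of `N` oscillators. The spring `spring j` connects the oscillators `j` and `j + 1`, and
the last spring connects the last and the first oscillator. A constant is `0` if there is no
spring; in particular the last constant is `0` for an open chain. -/
structure OscillatorChain (N : ℕ) where
  mass : Fin N → ℝ
  spring : Fin N → ℝ
  mass_pos : ∀ j, 0 < mass j
  spring_nonneg : ∀ j, 0 ≤ spring j

namespace OscillatorChain

variable {N : ℕ}

/-- The incidence matrix of the chain: column `j` is `e_j - e_{j+1}`, cyclically. -/
def incidence (N : ℕ) : Matrix (Fin N) (Fin N) ℝ :=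
  Matrix.of fun i j =>
    (if i = j then 1 else 0) - (if (i : ℕ) = ((j : ℕ) + 1) % N then 1 else 0)

/-- `B = √M⁻¹ Φ √W`. -/
noncomputable def keyMatrix (c : OscillatorChain N) : Matrix (Fin N) (Fin N) ℝ :=
  Matrix.diagonal (fun i => (Real.sqrt (c.mass i))⁻¹) * incidence N *
    Matrix.diagonal (fun j => Real.sqrt (c.spring j))

/-- The number of index qubits: `⌈log₂ N⌉`. -/
def indexQubits (N : ℕ) : ℕ := Nat.clog 2 N

/-- The matrix `B` as an operator on the index qubits, padded with zero rows and columns. -/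
noncomputable def paddedKeyMatrix (c : OscillatorChain N) :
    Matrix (Reg (Fin (indexQubits N))) (Reg (Fin (indexQubits N))) ℂ :=
  Matrix.of fun x y =>
    if h : (finFunctionFinEquiv x : ℕ) < N ∧ (finFunctionFinEquiv y : ℕ) < N then
      (c.keyMatrix ⟨finFunctionFinEquiv x, h.1⟩ ⟨finFunctionFinEquiv y, h.2⟩ : ℂ)
    else 0

/-- The Hamiltonian `- (|0⟩⟨1| ⊗ B + |1⟩⟨0| ⊗ B†)`; the first qubit selects the block. -/
noncomputable def hamiltonian (c : OscillatorChain N) :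
    Matrix (Reg (Fin (indexQubits N + 1))) (Reg (Fin (indexQubits N + 1))) ℂ :=
  - Matrix.of fun x y =>
    (if x 0 = 0 ∧ y 0 = 1 then c.paddedKeyMatrix (Fin.tail x) (Fin.tail y) else 0) +
    (if x 0 = 1 ∧ y 0 = 0 then c.paddedKeyMatrix.conjTranspose (Fin.tail x) (Fin.tail y) else 0)

/-- The time-evolution operator `exp (- i H t)`. -/
noncomputable def evolution (c : OscillatorChain N) (t : ℝ) :
    Matrix (Reg (Fin (indexQubits N + 1))) (Reg (Fin (indexQubits N + 1))) ℂ :=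
  NormedSpace.exp ((-(Complex.I * t)) • c.hamiltonian)

end OscillatorChain

/-- The signal state (with the flag: ancillas found in `0`) that is produced by the circuit unitary
`C` from the initial state `|0⟩ ⊗ ψ`. -/
noncomputable def outputState {α σ : Type} [Fintype α] [DecidableEq α] [Fintype σ]
    [DecidableEq σ] (C : Matrix (Reg (α ⊕ σ)) (Reg (α ⊕ σ)) ℂ) (ψ : QState σ) : QState σ :=
  flagged (applyOp C (withZeroAncilla ψ))

/-- The normalized state `ψ / ‖ψ‖`. -/
noncomputable def normalized {ι : Type} [Fintype ι] [DecidableEq ι] (ψ : QState ι) : QState ι :=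
  ((‖ψ‖⁻¹ : ℝ) : ℂ) • ψ

/-!
The evolution operator is encoded by quantum signal processing. A product of `k` alternating calls
of `U` and `U†`, in which every call is averaged over the two positions of the reflection `R` before
and after it, has a multiple of `H ^ k` as its all-zero block. Hence a polynomial in `H` of fixed
parity is encoded by one polynomial `f`, whose value at a point `z ^ 2` of the unit circle is, up to
a phase, the polynomial to be encoded at `Re z`. If `‖f‖ < 1` on the circle, then by the
Fejér–Riesz theorem `f` is the first entry of a vector of polynomials that has norm one on the
circle, and such vectors are built up by one rotation of a work qubit per call. The even and the odd
part of the truncated exponential series are bounded by `9 / 8` on the circle; scaled by `4 / 5`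
they are run in parallel in equal superposition, with the sub-normalization `2 * 5 / 4 = 5 / 2`.

For the amplification of `C` with all-zero block `A`, let `y m` be the image of the initial state
under the all-zero block of `m` iterations, and `x m` its image under the all-zero block of `m`
iterations followed by `C†`. These satisfy `x (m + 1) = x m - 2 A† (y m)` and
`y (m + 1) = y m + 2 A (x (m + 1))`, which is a rotation if `A` is a multiple of a unitary. Each
half-step replaces `A` by `-A` in the quadratic form `‖x‖ ^ 2 + ‖y‖ ^ 2 - 2 Re ⟪y, A x⟫` and leaves
its value unchanged, so the deviations of the half-steps only add up. There are about `2 α` of them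
and each is `O(δ / α)`, so the total error is `O(δ)` without a factor `α`.
-/

/-! ### Operators on some qubits of a register -/

section Registers

variable {ι κ μ : Type}

/-- Two basis states agree on all qubits outside the range of `f`; the operators `onQubits f u`
connect only such basis states. -/
def AgreeOff (f : κ ↪ ι) (x y : Reg ι) : Prop := ∀ i, (∀ k, f k ≠ i) → x i = y i

theorem agreeOff_refl (f : κ ↪ ι) (x : Reg ι) : AgreeOff f x x := fun _ _ => rfl

theorem AgreeOff.symm {f : κ ↪ ι} {x y : Reg ι} (h : AgreeOff f x y) : AgreeOff f y x :=
  fun i hi => (h i hi).symm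

theorem AgreeOff.trans {f : κ ↪ ι} {x y z : Reg ι} (h : AgreeOff f x y) (h' : AgreeOff f y z) :
    AgreeOff f x z :=
  fun i hi => (h i hi).trans (h' i hi)

theorem agreeOff_extend (f : κ ↪ ι) (z : Reg κ) (x : Reg ι) :
    AgreeOff f (Function.extend f z x) x :=
  fun _ hi => Function.extend_apply' _ _ _ fun ⟨k, hk⟩ => hi k hk

theorem agreeOff_extend_left_iff {f : κ ↪ ι} {z : Reg κ} {x y : Reg ι} :
    AgreeOff f (Function.extend f z x) y ↔ AgreeOff f x y :=
  ⟨(agreeOff_extend f z x).symm.trans, (agreeOff_extend f z x).trans⟩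

theorem AgreeOff.extend_comp_eq {f : κ ↪ ι} {x y : Reg ι} (h : AgreeOff f x y) :
    Function.extend f (y ∘ f) x = y := by
  funext i
  by_cases hi : ∃ k, f k = i
  · obtain ⟨k, rfl⟩ := hi
    exact f.injective.extend_apply _ _ _
  · rw [Function.extend_apply' _ _ _ hi]
    exact h i fun k hk => hi ⟨k, hk⟩

theorem AgreeOff.comp_eq_comp_iff {f : κ ↪ ι} {x y : Reg ι} (h : AgreeOff f x y) :
    x ∘ f = y ∘ f ↔ x = y := by
  refine ⟨fun hf => ?_, fun hxy => by rw [hxy]⟩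
  rw [← (agreeOff_refl f x).extend_comp_eq, hf, h.extend_comp_eq]

theorem agreeOff_trans_iff {f : κ ↪ ι} {g : μ ↪ κ} {x y : Reg ι} :
    AgreeOff (g.trans f) x y ↔ AgreeOff f x y ∧ AgreeOff g (x ∘ f) (y ∘ f) := by
  refine ⟨fun h => ⟨fun i hi => h i fun k => hi (g k), fun j hj => h (f j) fun k hk =>
    hj k (f.injective hk)⟩, fun ⟨hf, hg⟩ i hi => ?_⟩
  by_cases hfi : ∃ j, f j = i
  · obtain ⟨j, rfl⟩ := hfi
    exact hg j fun k hk => hi k (congrArg f hk)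
  · exact hf i fun j hj => hfi ⟨j, hj⟩

variable [Fintype ι] [DecidableEq ι] [Fintype κ] [DecidableEq κ] [Fintype μ] [DecidableEq μ]

instance (f : κ ↪ ι) (x y : Reg ι) : Decidable (AgreeOff f x y) :=
  inferInstanceAs (Decidable (∀ i, (∀ k, f k ≠ i) → x i = y i))

theorem onQubits_apply (f : κ ↪ ι) (u : Matrix (Reg κ) (Reg κ) ℂ) (x y : Reg ι) :
    onQubits f u x y = if AgreeOff f x y then u (x ∘ f) (y ∘ f) else 0 := rfl

theorem sum_onQubits_smul {E : Type*} [AddCommMonoid E] [Module ℂ E] (f : κ ↪ ι)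
    (u : Matrix (Reg κ) (Reg κ) ℂ) (x : Reg ι) (Ψ : Reg ι → E) :
    ∑ y, onQubits f u x y • Ψ y = ∑ z, u (x ∘ f) z • Ψ (Function.extend f z x) := by
  symm
  refine Finset.sum_of_injOn (fun z => Function.extend f z x)
    (Function.extend_injective f.injective x).injOn (by simp) (fun y _ hy => ?_) fun z _ => ?_
  · rw [onQubits_apply, if_neg fun h => hy ⟨y ∘ f, by simp, h.extend_comp_eq⟩, zero_smul]
  · rw [onQubits_apply, if_pos (agreeOff_extend f z x).symm, Function.extend_comp f.injective]

theorem onQubits_mul (f : κ ↪ ι) (u v : Matrix (Reg κ) (Reg κ) ℂ) :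
    onQubits f (u * v) = onQubits f u * onQubits f v := by
  ext x y
  have h := sum_onQubits_smul f u x fun z => onQubits f v z y
  simp only [smul_eq_mul] at h
  rw [Matrix.mul_apply, h]
  simp only [onQubits_apply, agreeOff_extend_left_iff, Function.extend_comp f.injective]
  split_ifs <;> simp [Matrix.mul_apply]

theorem onQubits_diagonal (f : κ ↪ ι) (d : Reg κ → ℂ) :
    onQubits f (Matrix.diagonal d) = Matrix.diagonal fun x => d (x ∘ f) := by
  ext x y
  rw [onQubits_apply]
  split_ifs with h
  · simp only [Matrix.diagonal_apply, h.comp_eq_comp_iff]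
  · rw [Matrix.diagonal_apply_ne]
    rintro rfl
    exact h (agreeOff_refl f x)

theorem onQubits_one (f : κ ↪ ι) : onQubits f (1 : Matrix (Reg κ) (Reg κ) ℂ) = 1 :=
  onQubits_diagonal f 1

theorem onQubits_conjTranspose (f : κ ↪ ι) (u : Matrix (Reg κ) (Reg κ) ℂ) :
    onQubits f u.conjTranspose = (onQubits f u).conjTranspose := by
  ext x y
  have hsymm : AgreeOff f x y ↔ AgreeOff f y x := ⟨AgreeOff.symm, AgreeOff.symm⟩
  simp only [Matrix.conjTranspose_apply, onQubits_apply, hsymm]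
  split_ifs <;> simp

theorem onQubits_trans (f : κ ↪ ι) (g : μ ↪ κ) (u : Matrix (Reg μ) (Reg μ) ℂ) :
    onQubits (g.trans f) u = onQubits f (onQubits g u) := by
  ext x y
  simp only [onQubits_apply, agreeOff_trans_iff, ite_and]
  rfl

theorem onQubits_mul_onQubits_apply {f : κ ↪ ι} {g : μ ↪ ι}
    (hfg : ∀ i, (∃ k, f k = i) ↔ ∀ j, g j ≠ i) (u : Matrix (Reg κ) (Reg κ) ℂ)
    (v : Matrix (Reg μ) (Reg μ) ℂ) (x y : Reg ι) :
    (onQubits f u * onQubits g v) x y = u (x ∘ f) (y ∘ f) * v (x ∘ g) (y ∘ g) := by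
  have hsum := sum_onQubits_smul f u x fun z => onQubits g v z y
  simp only [smul_eq_mul] at hsum
  rw [Matrix.mul_apply, hsum, Finset.sum_eq_single (y ∘ f)]
  · have hagree : AgreeOff g (Function.extend f (y ∘ f) x) y := fun i hi => by
      obtain ⟨k, rfl⟩ := (hfg i).mpr hi
      exact f.injective.extend_apply _ _ _
    have hg : Function.extend f (y ∘ f) x ∘ g = x ∘ g := funext fun j =>
      Function.extend_apply' _ _ _ fun hj => (hfg (g j)).mp hj j rfl
    rw [onQubits_apply, if_pos hagree, hg]
  · intro z _ hz
    rw [onQubits_apply, if_neg, mul_zero]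
    refine fun h => hz (funext fun k => ?_)
    rw [← f.injective.extend_apply z x k]
    exact h (f k) ((hfg (f k)).mp ⟨k, rfl⟩)
  · simp

theorem onQubits_mem_unitaryGroup (f : κ ↪ ι) {u : Matrix (Reg κ) (Reg κ) ℂ}
    (hu : u ∈ Matrix.unitaryGroup (Reg κ) ℂ) :
    onQubits f u ∈ Matrix.unitaryGroup (Reg ι) ℂ := by
  rw [Matrix.mem_unitaryGroup_iff, Matrix.star_eq_conjTranspose] at hu ⊢
  rw [← onQubits_conjTranspose, ← onQubits_mul, hu, onQubits_one]

theorem controlledOn_conjTranspose (q : ι) (u : Matrix (Reg ι) (Reg ι) ℂ) :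
    controlledOn q u.conjTranspose = (controlledOn q u).conjTranspose := by
  ext x y
  by_cases h : x q = y q
  · simp only [controlledOn, Matrix.of_apply, Matrix.conjTranspose_apply, h, if_true]
    split_ifs
    · rfl
    · rw [← Matrix.conjTranspose_apply, Matrix.conjTranspose_one]
  · simp [controlledOn, h, Ne.symm h]

theorem controlledOn_onQubits (f : κ ↪ ι) (q : κ) (u : Matrix (Reg κ) (Reg κ) ℂ) :
    controlledOn (f q) (onQubits f u) = onQubits f (controlledOn q u) := by
  ext x y
  rw [controlledOn, ← onQubits_one f]
  simp only [controlledOn, Matrix.of_apply, onQubits_apply]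
  split_ifs <;> simp_all

theorem controlledOn_mul (q : ι) {u : Matrix (Reg ι) (Reg ι) ℂ}
    (hu : ∀ x y, x q ≠ y q → u x y = 0) (v : Matrix (Reg ι) (Reg ι) ℂ) :
    controlledOn q (u * v) = controlledOn q u * controlledOn q v := by
  ext x y
  rw [Matrix.mul_apply]
  by_cases hx : x q = 1
  · by_cases hy : x q = y q
    · simp only [controlledOn, Matrix.of_apply, if_pos hx, if_pos hy, Matrix.mul_apply]
      refine Finset.sum_congr rfl fun z _ => ?_
      by_cases hz : x q = z q
      · rw [if_pos hz, if_pos (hz.symm.trans hy), if_pos (hz.symm.trans hx)]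
      · rw [if_neg hz, hu _ _ hz, zero_mul, zero_mul]
    · simp only [controlledOn, Matrix.of_apply, if_neg hy]
      refine (Finset.sum_eq_zero fun z _ => ?_).symm
      by_cases hz : x q = z q
      · rw [if_neg fun h => hy (hz.trans h), mul_zero]
      · rw [if_neg hz, zero_mul]
  · rw [Finset.sum_eq_single x]
    · simp [controlledOn, hx]
    · intro z _ hz
      simp [controlledOn, hx, hz.symm]
    · simp

theorem controlledOn_one (q : ι) : controlledOn q (1 : Matrix (Reg ι) (Reg ι) ℂ) = 1 := by
  ext x y
  by_cases h : x = y <;> simp [controlledOn, Matrix.one_apply, h]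

theorem controlledOn_onQubits_mem_unitaryGroup (f : κ ↪ ι) {q : ι} (hq : ∀ k, f k ≠ q)
    {u : Matrix (Reg κ) (Reg κ) ℂ} (hu : u ∈ Matrix.unitaryGroup (Reg κ) ℂ) :
    controlledOn q (onQubits f u) ∈ Matrix.unitaryGroup (Reg ι) ℂ := by
  have h := onQubits_mem_unitaryGroup f hu
  rw [Matrix.mem_unitaryGroup_iff, Matrix.star_eq_conjTranspose] at h ⊢
  have hpreserve : ∀ x y, x q ≠ y q → onQubits f u x y = 0 :=
    fun x y hxy => if_neg fun h => hxy (h q hq)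
  rw [← controlledOn_conjTranspose, ← controlledOn_mul q hpreserve, h, controlledOn_one]

theorem diagonal_mem_unitaryGroup {d : ι → ℂ} (hd : ∀ x, ‖d x‖ = 1) :
    Matrix.diagonal d ∈ Matrix.unitaryGroup ι ℂ := by
  rw [Matrix.mem_unitaryGroup_iff, Matrix.star_eq_conjTranspose, Matrix.diagonal_conjTranspose,
    Matrix.diagonal_mul_diagonal, ← Matrix.diagonal_one]
  congr 1
  funext x
  simp [Complex.mul_conj', hd x]

end Registers

/-! ### Circuits -/

section Circuits

variable {b a s : ℕ} {U : Matrix (Reg (Fin a ⊕ Fin s)) (Reg (Fin a ⊕ Fin s)) ℂ}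

theorem callWires_ne_work (q : Fin b) (k : Fin a ⊕ Fin s) :
    callWires b a s k ≠ Sum.inl (Sum.inl q) := by
  rcases k with k | k <;> simp [callWires]

namespace Gate

theorem eval_mem_unitaryGroup (hU : U ∈ Matrix.unitaryGroup (Reg (Fin a ⊕ Fin s)) ℂ)
    (g : Gate b a) : g.eval U ∈ Matrix.unitaryGroup (Reg (Wires b a s)) ℂ := by
  have hcall (inv : Bool) : (if inv then U.conjTranspose else U) ∈
      Matrix.unitaryGroup (Reg (Fin a ⊕ Fin s)) ℂ := by
    cases inv
    · exact hU
    · exact Unitary.star_mem hU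
  match g with
  | .call none inv => exact onQubits_mem_unitaryGroup _ (hcall inv)
  | .call (some q) inv =>
    exact controlledOn_onQubits_mem_unitaryGroup _ (callWires_ne_work q) (hcall inv)
  | .work g => exact onQubits_mem_unitaryGroup _ g.op.2
  | .phase φ p z =>
    refine diagonal_mem_unitaryGroup fun x => ?_
    split_ifs
    · rw [mul_comm, Complex.norm_exp_ofReal_mul_I]
    · exact norm_one

theorem eval_dagger (g : Gate b a) : g.dagger.eval U = (g.eval U).conjTranspose := by
  have hcall (inv : Bool) : (if (!inv) then U.conjTranspose else U) =
      (if inv then U.conjTranspose else U).conjTranspose := by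
    cases inv <;> simp
  match g with
  | .call none inv =>
    rw [dagger, eval, eval, hcall, onQubits_conjTranspose]
  | .call (some q) inv =>
    rw [dagger, eval, eval, hcall, onQubits_conjTranspose, controlledOn_conjTranspose]
  | .work g =>
    rw [eval, LocalGate.eval, ← onQubits_conjTranspose]
    rfl
  | .phase φ p z =>
    rw [dagger, eval, eval, Matrix.diagonal_conjTranspose]
    congr 1
    funext x
    rw [Pi.star_apply, apply_ite star, Complex.star_def, ← Complex.exp_conj]
    simp

/-- The wires of a circuit inside the register with one more work qubit, placed last. -/
def liftWires (b a s : ℕ) : Wires b a s ↪ Wires (b + 1) a s where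
  toFun := Sum.map (Sum.map Fin.castSucc id) id
  inj' := Sum.map_injective.mpr ⟨Sum.map_injective.mpr
    ⟨Fin.castSucc_injective b, Function.injective_id⟩, Function.injective_id⟩

theorem callWires_trans_liftWires :
    (callWires b a s).trans (liftWires b a s) = callWires (b + 1) a s := by
  ext k
  rcases k with k | k <;> rfl

theorem eval_lift (g : Gate b a) : g.lift.eval U = onQubits (liftWires b a s) (g.eval U) := by
  match g with
  | .call none inv =>
    rw [lift, Option.map_none, eval, eval, ← onQubits_trans, callWires_trans_liftWires]
  | .call (some q) inv =>
    simp only [lift, eval, Option.map_some]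
    rw [← controlledOn_onQubits, ← onQubits_trans, callWires_trans_liftWires]
    rfl
  | .work g =>
    rw [eval, LocalGate.eval, ← onQubits_trans]
    rfl
  | .phase φ p z =>
    have hsnoc (x : Reg (Wires (b + 1) a s)) :
        (∀ q v, Fin.snoc (α := fun _ => Option (Fin 2)) p none q = some v →
          x (Sum.inl (Sum.inl q)) = v) ↔
        ∀ q v, p q = some v → x (Sum.inl (Sum.inl q.castSucc)) = v := by
      simp [Fin.forall_fin_succ']
    rw [lift, eval, eval, onQubits_diagonal]
    simp only [hsnoc]
    rfl

theorem isCall_dagger (g : Gate b a) : g.dagger.isCall = g.isCall := by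
  cases g <;> rfl

theorem isCall_lift (g : Gate b a) : g.lift.isCall = g.isCall := by
  cases g <;> rfl

end Gate

namespace Circuit

theorem eval_mem_unitaryGroup (hU : U ∈ Matrix.unitaryGroup (Reg (Fin a ⊕ Fin s)) ℂ)
    (c : Circuit b a) : c.eval U ∈ Matrix.unitaryGroup (Reg (Wires b a s)) ℂ := by
  induction c with
  | nil => exact one_mem _
  | cons g c ih => exact mul_mem ih (g.eval_mem_unitaryGroup hU)

theorem eval_append (c d : Circuit b a) : eval U (c ++ d) = eval U d * eval U c := by
  induction c with
  | nil => simp [eval]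
  | cons g c ih => rw [List.cons_append, eval, ih, eval, mul_assoc]

theorem eval_singleton (g : Gate b a) : eval U [g] = g.eval U := one_mul _

theorem eval_flatten_replicate (m : ℕ) (c : Circuit b a) :
    eval U (List.replicate m c).flatten = eval U c ^ m := by
  induction m with
  | zero => rfl
  | succ m ih => rw [List.replicate_succ, List.flatten_cons, eval_append, ih, pow_succ]

theorem eval_dagger (c : Circuit b a) : eval U c.dagger = (eval U c).conjTranspose := by
  induction c with
  | nil => exact Matrix.conjTranspose_one.symm
  | cons g c ih =>
    have hcons : dagger (g :: c) = dagger c ++ [g.dagger] := by simp [dagger]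
    rw [hcons, eval_append, eval_singleton, ih, Gate.eval_dagger, eval, Matrix.conjTranspose_mul]

theorem eval_map_lift (c : Circuit b a) :
    eval U (c.map Gate.lift) = onQubits (Gate.liftWires b a s) (eval U c) := by
  induction c with
  | nil => exact (onQubits_one _).symm
  | cons g c ih => rw [List.map_cons, eval, ih, Gate.eval_lift, eval, onQubits_mul]

theorem calls_add_otherGates (c : Circuit b a) : c.calls + c.otherGates = c.length := by
  rw [calls, otherGates, List.length_eq_countP_add_countP (fun g : Gate b a => g.isCall)]
  simp

theorem calls_append (c d : Circuit b a) : calls (c ++ d) = c.calls + d.calls :=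
  List.countP_append

theorem otherGates_append (c d : Circuit b a) :
    otherGates (c ++ d) = c.otherGates + d.otherGates :=
  List.countP_append

theorem calls_dagger (c : Circuit b a) : c.dagger.calls = c.calls := by
  simp only [calls, dagger, List.countP_reverse, List.countP_map, Function.comp_def,
    Gate.isCall_dagger]

theorem calls_damp (θ : ℝ) (c : Circuit b a) : (c.damp θ).calls = c.calls := by
  simp only [calls, damp, List.countP_append, List.countP_map, Function.comp_def,
    Gate.isCall_lift]
  simp [Gate.isCall]

theorem otherGates_damp (θ : ℝ) (c : Circuit b a) :
    (c.damp θ).otherGates = c.otherGates + 1 := by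
  have hlength : (c.damp θ).length = c.length + 1 := by simp [damp]
  have hcalls := calls_damp θ c
  have h := calls_add_otherGates c
  have h' := calls_add_otherGates (c.damp θ)
  lia

theorem calls_amplify (m : ℕ) (c : Circuit b a) :
    (c.amplify m).calls = (2 * m + 1) * c.calls := by
  have hgrover : (grover c).calls = 2 * c.calls := by
    rw [grover, calls_append, calls_append, calls_append, calls_append, calls_dagger]
    simp only [calls, reflection, negOne, Gate.isCall, List.countP_singleton]
    simp [two_mul]
  rw [calls] at hgrover
  simp only [calls, amplify, List.countP_append, List.countP_flatten, List.map_replicate,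
    List.sum_replicate, hgrover, smul_eq_mul]
  ring

theorem otherGates_amplify (m : ℕ) (c : Circuit b a) :
    (c.amplify m).otherGates = (2 * m + 1) * c.otherGates + 3 * m := by
  have hlength : (c.amplify m).length = (2 * m + 1) * c.length + 3 * m := by
    simp [amplify, grover, dagger]
    ring
  have hcalls := calls_amplify m c
  have h := calls_add_otherGates c
  have h' := calls_add_otherGates (c.amplify m)
  rw [← h, mul_add] at hlength
  lia

theorem callCost_amplify_damp_le (G : ℕ) (θ : ℝ) (c : Circuit b a) {m : ℕ} {k : ℤ}
    (hm : (m : ℤ) ≤ k) :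
    (((c.damp θ).amplify m).callCost G : ℤ) ≤ (2 * k + 1) * (c.callCost G : ℤ) := by
  rw [callCost, callCost, calls_amplify, calls_damp, mul_assoc]
  push_cast
  gcongr

theorem otherGates_amplify_damp_le (θ : ℝ) (c : Circuit b a) {m : ℕ} {k : ℤ} (hm : (m : ℤ) ≤ k) :
    (((c.damp θ).amplify m).otherGates : ℤ) ≤ 3 * ((2 * k + 1) * (c.otherGates + 1)) := by
  calc (((c.damp θ).amplify m).otherGates : ℤ)
      = (2 * m + 1) * (c.otherGates + 1) + 3 * m := by
        rw [otherGates_amplify, otherGates_damp]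
        push_cast
        rfl
    _ ≤ 3 * ((2 * m + 1) * (c.otherGates + 1)) := by nlinarith
    _ ≤ 3 * ((2 * k + 1) * (c.otherGates + 1)) := by gcongr

end Circuit

end Circuits

/-! ### Blocks of operators on ancilla and signal qubits -/

section Blocks

/-- The projector `|0⟩⟨0| ⊗ I` onto the all-zero state of the ancilla qubits. -/
noncomputable def zeroProj (α σ : Type) [Fintype α] [Fintype σ] :
    Matrix (Reg (α ⊕ σ)) (Reg (α ⊕ σ)) ℂ :=
  Matrix.diagonal fun x => if ∀ i, x (Sum.inl i) = 0 then 1 else 0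

/-- The reflection `R = I - 2 |0⟩⟨0| ⊗ I` of amplitude amplification. -/
noncomputable def zeroReflection (α σ : Type) [Fintype α] [Fintype σ] :
    Matrix (Reg (α ⊕ σ)) (Reg (α ⊕ σ)) ℂ :=
  1 - (2 : ℂ) • zeroProj α σ

variable {α σ : Type}

theorem zeroBlock_add (M N : Matrix (Reg (α ⊕ σ)) (Reg (α ⊕ σ)) ℂ) :
    zeroBlock (M + N) = zeroBlock M + zeroBlock N := rfl

theorem zeroBlock_sub (M N : Matrix (Reg (α ⊕ σ)) (Reg (α ⊕ σ)) ℂ) :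
    zeroBlock (M - N) = zeroBlock M - zeroBlock N := rfl

theorem zeroBlock_neg (M : Matrix (Reg (α ⊕ σ)) (Reg (α ⊕ σ)) ℂ) :
    zeroBlock (-M) = -zeroBlock M := rfl

theorem zeroBlock_smul (c : ℂ) (M : Matrix (Reg (α ⊕ σ)) (Reg (α ⊕ σ)) ℂ) :
    zeroBlock (c • M) = c • zeroBlock M := rfl

theorem zeroBlock_sum {ι : Type*} (t : Finset ι)
    (M : ι → Matrix (Reg (α ⊕ σ)) (Reg (α ⊕ σ)) ℂ) :
    zeroBlock (∑ i ∈ t, M i) = ∑ i ∈ t, zeroBlock (M i) := by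
  ext x y
  simp [zeroBlock, Matrix.sum_apply]

theorem zeroBlock_conjTranspose (M : Matrix (Reg (α ⊕ σ)) (Reg (α ⊕ σ)) ℂ) :
    zeroBlock M.conjTranspose = (zeroBlock M).conjTranspose := rfl

variable [Fintype α] [Fintype σ]

theorem zeroBlock_one : zeroBlock (1 : Matrix (Reg (α ⊕ σ)) (Reg (α ⊕ σ)) ℂ) = 1 := by
  ext x y
  simp only [zeroBlock, Matrix.of_apply, Matrix.one_apply]
  congr 1
  exact propext ⟨fun h => funext fun j => congrFun h (Sum.inr j), fun h => by rw [h]⟩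

theorem zeroReflection_eq_diagonal :
    zeroReflection α σ = Matrix.diagonal fun x => if ∀ i, x (Sum.inl i) = 0 then -1 else 1 := by
  rw [zeroReflection, zeroProj, ← Matrix.diagonal_one, ← Matrix.diagonal_smul,
    Matrix.diagonal_sub]
  congr 1
  funext x
  simp only [Pi.smul_apply]
  split_ifs <;> norm_num

variable [DecidableEq α] [DecidableEq σ]

theorem sum_zero_ancilla {E : Type*} [AddCommMonoid E] (f : Reg (α ⊕ σ) → E) :
    ∑ x, (if ∀ i, x (Sum.inl i) = 0 then f x else 0) =
      ∑ y : Reg σ, f (Sum.elim (fun _ => 0) y) := by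
  symm
  refine Finset.sum_of_injOn (fun y => Sum.elim (fun _ => 0) y)
    (fun y _ z _ h => funext fun j => congrFun h (Sum.inr j)) (by simp) (fun x _ hx => ?_)
    fun y _ => by simp
  refine if_neg fun h => hx ⟨fun j => x (Sum.inr j), by simp, ?_⟩
  funext k
  rcases k with k | k
  · exact (h k).symm
  · rfl

theorem zeroBlock_mul_zeroProj_mul (M N : Matrix (Reg (α ⊕ σ)) (Reg (α ⊕ σ)) ℂ) :
    zeroBlock (M * zeroProj α σ * N) = zeroBlock M * zeroBlock N := by
  ext x y
  rw [Matrix.mul_apply, zeroBlock, Matrix.of_apply, Matrix.mul_apply]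
  simp only [zeroBlock, Matrix.of_apply, zeroProj, Matrix.mul_diagonal]
  rw [← sum_zero_ancilla fun z => M (Sum.elim (fun _ => 0) x) z * N z (Sum.elim (fun _ => 0) y)]
  refine Finset.sum_congr rfl fun z _ => ?_
  split_ifs <;> simp

theorem zeroBlock_mul_zeroReflection_mul (M N : Matrix (Reg (α ⊕ σ)) (Reg (α ⊕ σ)) ℂ) :
    zeroBlock (M * zeroReflection α σ * N) =
      zeroBlock (M * N) - (2 : ℂ) • (zeroBlock M * zeroBlock N) := by
  rw [zeroReflection, mul_sub, sub_mul, mul_one, Matrix.mul_smul, Matrix.smul_mul, zeroBlock_sub,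
    zeroBlock_smul, zeroBlock_mul_zeroProj_mul]

theorem zeroBlock_zeroReflection_mul (M : Matrix (Reg (α ⊕ σ)) (Reg (α ⊕ σ)) ℂ) :
    zeroBlock (zeroReflection α σ * M) = -zeroBlock M := by
  have h := zeroBlock_mul_zeroReflection_mul 1 M
  rw [one_mul, one_mul, zeroBlock_one, one_mul] at h
  rw [h, two_smul]
  abel

theorem outputState_eq (C : Matrix (Reg (α ⊕ σ)) (Reg (α ⊕ σ)) ℂ) (ψ : QState σ) :
    outputState C ψ = applyOp (zeroBlock C) ψ := by
  ext x
  simp only [outputState, flagged, applyOp, Matrix.ofLp_toEuclideanCLM, withZeroAncilla,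
    Matrix.mulVec, dotProduct, zeroBlock, Matrix.of_apply]
  refine Eq.trans ?_ (sum_zero_ancilla fun z =>
    C (Sum.elim (fun _ => 0) x) z * ψ fun j => z (Sum.inr j))
  refine Finset.sum_congr rfl fun z _ => ?_
  split_ifs <;> simp

theorem norm_withZeroAncilla (ψ : QState σ) :
    ‖(withZeroAncilla ψ : QState (α ⊕ σ))‖ = ‖ψ‖ := by
  rw [EuclideanSpace.norm_eq, EuclideanSpace.norm_eq]
  congr 1
  refine Eq.trans ?_ (sum_zero_ancilla fun z : Reg (α ⊕ σ) => ‖ψ fun j => z (Sum.inr j)‖ ^ 2)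
  refine Finset.sum_congr rfl fun z _ => ?_
  simp only [withZeroAncilla]
  split_ifs <;> simp

theorem norm_flagged_le (φ : QState (α ⊕ σ)) : ‖flagged φ‖ ≤ ‖φ‖ := by
  rw [EuclideanSpace.norm_eq, EuclideanSpace.norm_eq]
  apply Real.sqrt_le_sqrt
  simp only [flagged]
  rw [← sum_zero_ancilla (fun z : Reg (α ⊕ σ) => ‖φ z‖ ^ 2)]
  refine Finset.sum_le_sum fun z _ => ?_
  split_ifs
  · exact le_rfl
  · positivity

theorem norm_applyOp_of_mem_unitaryGroup {ι : Type} [Fintype ι] [DecidableEq ι]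
    {V : Matrix (Reg ι) (Reg ι) ℂ} (hV : V ∈ Matrix.unitaryGroup (Reg ι) ℂ) (ψ : QState ι) :
    ‖applyOp V ψ‖ = ‖ψ‖ := by
  have h : Matrix.toEuclideanCLM (𝕜 := ℂ) V ∈ unitary (QState ι →L[ℂ] QState ι) :=
    Unitary.map_mem (Matrix.toEuclideanCLM (𝕜 := ℂ)) hV
  exact ContinuousLinearMap.norm_map_of_mem_unitary h ψ

theorem norm_outputState_le {C : Matrix (Reg (α ⊕ σ)) (Reg (α ⊕ σ)) ℂ}
    (hC : C ∈ Matrix.unitaryGroup (Reg (α ⊕ σ)) ℂ) (ψ : QState σ) :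
    ‖outputState C ψ‖ ≤ ‖ψ‖ :=
  (norm_flagged_le _).trans (by rw [norm_applyOp_of_mem_unitaryGroup hC, norm_withZeroAncilla])

theorem specNorm_zeroBlock_le_one {C : Matrix (Reg (α ⊕ σ)) (Reg (α ⊕ σ)) ℂ}
    (hC : C ∈ Matrix.unitaryGroup (Reg (α ⊕ σ)) ℂ) : specNorm (zeroBlock C) ≤ 1 := by
  refine ContinuousLinearMap.opNorm_le_bound _ zero_le_one fun ψ => ?_
  have h := norm_outputState_le hC ψ
  rwa [outputState_eq, applyOp, ← one_mul ‖ψ‖] at h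

theorem Circuit.zeroBlock_eval_damp {b a s : ℕ}
    {U : Matrix (Reg (Fin a ⊕ Fin s)) (Reg (Fin a ⊕ Fin s)) ℂ} (θ : ℝ) (c : Circuit b a) :
    zeroBlock ((c.damp θ).eval U) = (Real.cos θ : ℂ) • zeroBlock (c.eval U) := by
  have hzero (x : Reg (Fin s)) : (Sum.elim (fun _ => 0) x : Reg (Wires (b + 1) a s)) ∘
      Gate.liftWires b a s = Sum.elim (fun _ => 0) x := by
    funext k
    rcases k with k | k <;> rfl
  obtain ⟨f, hf, heval⟩ : ∃ f : Fin 1 ↪ Wires (b + 1) a s,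
      (∀ k, f k = Sum.inl (Sum.inl (Fin.last b))) ∧ (c.damp θ).eval U =
        onQubits f (rotation θ) * onQubits (Gate.liftWires b a s) (c.eval U) :=
    ⟨_, fun _ => rfl, by rw [damp, eval_append, eval_singleton, eval_map_lift]; rfl⟩
  have hcover (i : Wires (b + 1) a s) : (∃ k, f k = i) ↔ ∀ j, Gate.liftWires b a s j ≠ i := by
    rcases i with (i | i) | i
    · induction i using Fin.lastCases <;>
        simp [hf, Gate.liftWires, Fin.castSucc_ne_last, (Fin.castSucc_ne_last _).symm]
    · simp [hf, Gate.liftWires]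
    · simp [hf, Gate.liftWires]
  ext x y
  rw [heval, zeroBlock, Matrix.of_apply, onQubits_mul_onQubits_apply hcover, hzero, hzero]
  simp [rotation, zeroBlock, hf]

end Blocks

/-! ### Oblivious amplitude amplification -/

section Amplification

/-- The oblivious Grover iteration `- C R C† R` of an operator `C` on ancilla and signal qubits,
where `R` is the reflection about the all-zero ancilla state. -/
noncomputable def groverStep {α σ : Type} [Fintype α] [DecidableEq α] [Fintype σ] [DecidableEq σ]
    (C : Matrix (Reg (α ⊕ σ)) (Reg (α ⊕ σ)) ℂ) : Matrix (Reg (α ⊕ σ)) (Reg (α ⊕ σ)) ℂ :=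
  -(C * zeroReflection α σ * C.conjTranspose * zeroReflection α σ)

section

variable {α σ : Type} [Fintype α] [DecidableEq α] [Fintype σ] [DecidableEq σ]
  {C : Matrix (Reg (α ⊕ σ)) (Reg (α ⊕ σ)) ℂ}

theorem zeroBlock_conjTranspose_mul_groverStep_mul
    (hC : C ∈ Matrix.unitaryGroup (Reg (α ⊕ σ)) ℂ) (M : Matrix (Reg (α ⊕ σ)) (Reg (α ⊕ σ)) ℂ) :
    zeroBlock (C.conjTranspose * (groverStep C * M)) =
      zeroBlock (C.conjTranspose * M) -
        (2 : ℂ) • ((zeroBlock C).conjTranspose * zeroBlock M) := by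
  have hCC : C.conjTranspose * C = 1 := Matrix.mem_unitaryGroup_iff'.mp hC
  have hcancel : C.conjTranspose * (groverStep C * M) =
      -(zeroReflection α σ * (C.conjTranspose * zeroReflection α σ * M)) := by
    rw [groverStep, neg_mul, mul_neg]
    simp only [← mul_assoc]
    rw [hCC, one_mul]
  rw [hcancel, zeroBlock_neg, zeroBlock_zeroReflection_mul, neg_neg,
    zeroBlock_mul_zeroReflection_mul, zeroBlock_conjTranspose]

theorem zeroBlock_groverStep_mul
    (hC : C ∈ Matrix.unitaryGroup (Reg (α ⊕ σ)) ℂ) (M : Matrix (Reg (α ⊕ σ)) (Reg (α ⊕ σ)) ℂ) :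
    zeroBlock (groverStep C * M) =
      zeroBlock M +
        (2 : ℂ) • (zeroBlock C * zeroBlock (C.conjTranspose * (groverStep C * M))) := by
  have hCC : C * C.conjTranspose = 1 := Matrix.mem_unitaryGroup_iff.mp hC
  have hproduct := zeroBlock_mul_zeroReflection_mul C (C.conjTranspose * zeroReflection α σ * M)
  have hcancel : C * (C.conjTranspose * zeroReflection α σ * M) = zeroReflection α σ * M := by
    rw [← mul_assoc, ← mul_assoc, hCC, one_mul]
  have hgrover : groverStep C * M =
      -(C * zeroReflection α σ * (C.conjTranspose * zeroReflection α σ * M)) := by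
    rw [groverStep, neg_mul]
    simp only [mul_assoc]
  rw [zeroBlock_conjTranspose_mul_groverStep_mul hC, ← zeroBlock_conjTranspose,
    ← zeroBlock_mul_zeroReflection_mul, hgrover, zeroBlock_neg, hproduct, hcancel,
    zeroBlock_zeroReflection_mul]
  abel

end

namespace Circuit

variable {b a s : ℕ} (U : Matrix (Reg (Fin a ⊕ Fin s)) (Reg (Fin a ⊕ Fin s)) ℂ)

theorem eval_reflection :
    (reflection : Gate b a).eval U = zeroReflection (Fin b ⊕ Fin a) (Fin s) := by
  rw [zeroReflection_eq_diagonal, reflection, Gate.eval]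
  congr 1
  funext x
  congr 1
  · simp
  · rw [mul_comm, Complex.exp_pi_mul_I]

theorem eval_negOne : (negOne : Gate b a).eval U = -1 := by
  rw [negOne, Gate.eval, ← Matrix.diagonal_one, Matrix.diagonal_neg]
  congr 1
  funext x
  rw [if_pos (by simp), mul_comm, Complex.exp_pi_mul_I]

theorem eval_amplify (m : ℕ) (c : Circuit b a) :
    (c.amplify m).eval U = groverStep (c.eval U) ^ m * c.eval U := by
  have hgrover : c.grover.eval U = groverStep (c.eval U) := by
    simp only [grover, eval_append, eval_singleton, eval_reflection, eval_negOne, eval_dagger]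
    simp [groverStep, mul_assoc]
  rw [amplify, eval_append, eval_flatten_replicate, hgrover]

end Circuit

end Amplification

/-! ### Stability of the amplification recursion -/

section Stability

open ContinuousLinearMap

variable {F G : Type*} [NormedAddCommGroup F] [InnerProductSpace ℂ F] [NormedAddCommGroup G]
  [InnerProductSpace ℂ G]

/-- The quadratic form that is preserved by the steps of the amplification recursion: each step
replaces `A` by `-A`, and completing the square in the variable it changes leaves the value
unchanged. -/
noncomputable def amplifyEnergy (A : F →L[ℂ] G) (x : F) (y : G) : ℝ :=
  ‖x‖ ^ 2 + ‖y‖ ^ 2 - 2 * RCLike.re (inner ℂ y (A x))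

theorem amplifyEnergy_eq_left (A : F →L[ℂ] G) (x : F) (y : G) :
    amplifyEnergy A x y = ‖y - A x‖ ^ 2 + (‖x‖ ^ 2 - ‖A x‖ ^ 2) := by
  rw [amplifyEnergy, @norm_sub_sq ℂ]
  ring

theorem add_sq_le_of_add_sq_le {e μ p q g : ℝ} (he : 0 ≤ e) (hμ : 0 ≤ μ) (hg : 0 ≤ g)
    (h : p ^ 2 + g ≤ e ^ 2) (hq : q ≤ p + μ) (hq0 : 0 ≤ q) : q ^ 2 + g ≤ (e + μ) ^ 2 := by
  have hp : p ≤ e := abs_le_of_sq_le_sq' (by linarith) he |>.2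
  nlinarith [pow_le_pow_left₀ hq0 hq 2, mul_le_mul_of_nonneg_right hp hμ]

theorem norm_map_sq_le_of_norm_le_one {A : F →L[ℂ] G} (hA : ‖A‖ ≤ 1) (x : F) :
    ‖A x‖ ^ 2 ≤ ‖x‖ ^ 2 :=
  pow_le_pow_left₀ (norm_nonneg _)
    ((A.le_opNorm x).trans (mul_le_of_le_one_left (norm_nonneg x) hA)) 2

theorem amplifyEnergy_step_right {A : F →L[ℂ] G} (hA : ‖A‖ ≤ 1) {x : F} {y f : G} {e μ : ℝ}
    (he : 0 ≤ e) (h : amplifyEnergy (-A) x y ≤ e ^ 2) (hf : ‖f‖ ≤ μ) :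
    amplifyEnergy A x (y + (2 : ℂ) • A x + f) ≤ (e + μ) ^ 2 := by
  rw [amplifyEnergy_eq_left] at h ⊢
  have hsub : y + (2 : ℂ) • A x + f - A x = y - (-A) x + f := by
    rw [neg_apply]
    module
  rw [neg_apply, norm_neg] at h
  rw [hsub, neg_apply]
  exact add_sq_le_of_add_sq_le he ((norm_nonneg _).trans hf)
    (sub_nonneg.mpr (norm_map_sq_le_of_norm_le_one hA x)) h
    ((norm_add_le _ f).trans (by gcongr)) (norm_nonneg _)

theorem norm_two_smul_map_smul_le {T : F →L[ℂ] G} {r μ : ℝ} {v : F} (hT : ‖T‖ ≤ μ)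
    (hr : |r| ≤ 1) (hv : ‖v‖ ≤ 1) : ‖(2 : ℂ) • T ((r : ℂ) • v)‖ ≤ 2 * μ := by
  have hrv : ‖(r : ℂ) • v‖ ≤ 1 := by
    rw [norm_smul, Complex.norm_real, Real.norm_eq_abs]
    exact mul_le_one₀ hr (norm_nonneg v) hv
  rw [norm_smul, RCLike.norm_ofNat]
  gcongr
  exact (T.le_opNorm_of_le hrv).trans (by rwa [mul_one])

/-- A step of the recursion compared with the rotation by `φ` that it would be if `A` were
`sin φ • E`. -/
theorem amplifyEnergy_rotate_right {A E : F →L[ℂ] G} {φ μ : ℝ}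
    (hμ : ‖A - (Real.sin φ : ℂ) • E‖ ≤ μ) (hA : ‖A‖ ≤ 1) {ψ : F} (hψ : ‖ψ‖ ≤ 1) {x : F} {y : G}
    {e θ : ℝ} (he : 0 ≤ e)
    (h : amplifyEnergy (-A) (x - (Real.cos θ : ℂ) • ψ) (y - (Real.sin (θ - φ) : ℂ) • E ψ) ≤
      e ^ 2) :
    amplifyEnergy A (x - (Real.cos θ : ℂ) • ψ)
      (y + (2 : ℂ) • A x - (Real.sin (θ + φ) : ℂ) • E ψ) ≤ (e + 2 * μ) ^ 2 := by
  have hstep := amplifyEnergy_step_right hA he h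
    (norm_two_smul_map_smul_le hμ (Real.abs_cos_le_one θ) hψ)
  have htrig : Real.sin (θ + φ) = Real.sin (θ - φ) + 2 * Real.sin φ * Real.cos θ := by
    rw [Real.sin_add, Real.sin_sub]
    ring
  convert hstep using 2
  simp only [htrig, map_sub, map_smul, sub_apply, smul_apply, Complex.ofReal_add,
    Complex.ofReal_mul, Complex.ofReal_ofNat]
  module

variable [CompleteSpace F] [CompleteSpace G]

theorem amplifyEnergy_eq_right (A : F →L[ℂ] G) (x : F) (y : G) :
    amplifyEnergy A x y = ‖x - adjoint A y‖ ^ 2 + (‖y‖ ^ 2 - ‖adjoint A y‖ ^ 2) := by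
  rw [amplifyEnergy, @norm_sub_sq ℂ, adjoint_inner_right, inner_re_symm]
  ring

theorem amplifyEnergy_step_left {A : F →L[ℂ] G} (hA : ‖A‖ ≤ 1) {x f : F} {y : G} {e μ : ℝ}
    (he : 0 ≤ e) (h : amplifyEnergy A x y ≤ e ^ 2) (hf : ‖f‖ ≤ μ) :
    amplifyEnergy (-A) (x - (2 : ℂ) • adjoint A y + f) y ≤ (e + μ) ^ 2 := by
  rw [amplifyEnergy_eq_right] at h ⊢
  have hsub : x - (2 : ℂ) • adjoint A y + f - adjoint (-A) y = x - adjoint A y + f := by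
    rw [map_neg, neg_apply]
    module
  have hA' : ‖adjoint A‖ ≤ 1 := by rwa [LinearIsometryEquiv.norm_map]
  rw [hsub, map_neg, neg_apply, norm_neg]
  exact add_sq_le_of_add_sq_le he ((norm_nonneg _).trans hf)
    (sub_nonneg.mpr (norm_map_sq_le_of_norm_le_one hA' y)) h
    ((norm_add_le _ f).trans (by gcongr)) (norm_nonneg _)

theorem amplifyEnergy_rotate_left {A E : F →L[ℂ] G} (hE : ∀ v, ‖E v‖ = ‖v‖) {φ μ : ℝ}
    (hμ : ‖A - (Real.sin φ : ℂ) • E‖ ≤ μ) (hA : ‖A‖ ≤ 1) {ψ : F} (hψ : ‖ψ‖ ≤ 1) {x : F} {y : G}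
    {e θ : ℝ} (he : 0 ≤ e)
    (h : amplifyEnergy A (x - (Real.cos (θ - φ) : ℂ) • ψ) (y - (Real.sin θ : ℂ) • E ψ) ≤ e ^ 2) :
    amplifyEnergy (-A) (x - (2 : ℂ) • adjoint A y - (Real.cos (θ + φ) : ℂ) • ψ)
      (y - (Real.sin θ : ℂ) • E ψ) ≤ (e + 2 * μ) ^ 2 := by
  have hμ' : ‖adjoint (A - (Real.sin φ : ℂ) • E)‖ ≤ μ := by rwa [LinearIsometryEquiv.norm_map]
  have hEψ : adjoint E (E ψ) = ψ :=
    DFunLike.congr_fun (E.norm_map_iff_adjoint_comp_self.mp hE) ψ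
  have hstep := amplifyEnergy_step_left hA he h (f := -_) ((norm_neg _).trans_le
    (norm_two_smul_map_smul_le hμ' (Real.abs_sin_le_one θ) ((hE ψ).trans_le hψ)))
  have htrig : Real.cos (θ + φ) = Real.cos (θ - φ) - 2 * Real.sin φ * Real.sin θ := by
    rw [Real.cos_add, Real.cos_sub]
    ring
  convert hstep using 2
  simp only [htrig, map_sub, map_smul, LinearIsometryEquiv.map_smulₛₗ, Complex.conj_ofReal,
    sub_apply, smul_apply, hEψ, Complex.ofReal_sub, Complex.ofReal_mul, Complex.ofReal_ofNat]
  module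

theorem amplifyEnergy_le {A E : F →L[ℂ] G} (hE : ∀ v, ‖E v‖ = ‖v‖) {φ μ : ℝ}
    (hμ : ‖A - (Real.sin φ : ℂ) • E‖ ≤ μ) (hA : ‖A‖ ≤ 1) {ψ : F} (hψ : ‖ψ‖ ≤ 1)
    {x : ℕ → F} {y : ℕ → G} (hx0 : x 0 = ψ) (hy0 : y 0 = A ψ)
    (hx : ∀ m, x (m + 1) = x m - (2 : ℂ) • adjoint A (y m))
    (hy : ∀ m, y (m + 1) = y m + (2 : ℂ) • A (x (m + 1))) (m : ℕ) :
    amplifyEnergy A (x m - (Real.cos (2 * m * φ) : ℂ) • ψ)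
      (y m - (Real.sin ((2 * m + 1) * φ) : ℂ) • E ψ) ≤ ((4 * m + 1) * μ) ^ 2 := by
  have hμ0 : 0 ≤ μ := (norm_nonneg _).trans hμ
  induction m with
  | zero =>
    have hy0' : ‖A ψ - (Real.sin φ : ℂ) • E ψ‖ ≤ μ :=
      ((A - (Real.sin φ : ℂ) • E).le_of_opNorm_le_of_le hμ hψ).trans_eq (mul_one μ)
    simpa [amplifyEnergy, hx0, hy0] using pow_le_pow_left₀ (norm_nonneg _) hy0' 2
  | succ m ih =>
    have hangle : (2 * m + 1) * φ - φ = 2 * m * φ := by ring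
    have hangle' : (2 * m + 1) * φ + φ = 2 * (m + 1 : ℕ) * φ := by push_cast; ring
    have hangle'' : 2 * (m + 1 : ℕ) * φ - φ = (2 * m + 1) * φ := by push_cast; ring
    have hangle''' : 2 * (m + 1 : ℕ) * φ + φ = (2 * (m + 1 : ℕ) + 1) * φ := by ring
    rw [← hangle] at ih
    have hleft := amplifyEnergy_rotate_left hE hμ hA hψ (by positivity) ih
    rw [← hx, hangle', ← hangle''] at hleft
    have hright := amplifyEnergy_rotate_right hμ hA hψ (by positivity) hleft
    rw [← hy, hangle'''] at hright
    exact hright.trans_eq (by push_cast; ring)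

theorem norm_amplify_sub_sq_le {A E : F →L[ℂ] G} (hE : ∀ v, ‖E v‖ = ‖v‖) {φ μ : ℝ}
    (hμ : ‖A - (Real.sin φ : ℂ) • E‖ ≤ μ) (hA : ‖A‖ ≤ 1) {ψ : F} (hψ : ‖ψ‖ ≤ 1)
    {x : ℕ → F} {y : ℕ → G} (hx0 : x 0 = ψ) (hy0 : y 0 = A ψ)
    (hx : ∀ m, x (m + 1) = x m - (2 : ℂ) • adjoint A (y m))
    (hy : ∀ m, y (m + 1) = y m + (2 : ℂ) • A (x (m + 1))) (m : ℕ) :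
    (1 - ‖A‖ ^ 2) * ‖y m - (Real.sin ((2 * m + 1) * φ) : ℂ) • E ψ‖ ^ 2 ≤
      ((4 * m + 1) * μ) ^ 2 := by
  refine le_trans ?_ (amplifyEnergy_le hE hμ hA hψ hx0 hy0 hx hy m)
  set v := y m - (Real.sin ((2 * m + 1) * φ) : ℂ) • E ψ
  have hv : ‖adjoint A v‖ ^ 2 ≤ (‖A‖ * ‖v‖) ^ 2 := by
    rw [← adjoint.norm_map A]
    exact pow_le_pow_left₀ (norm_nonneg _) ((adjoint A).le_opNorm v) 2
  rw [amplifyEnergy_eq_right]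
  nlinarith [sq_nonneg ‖x m - (Real.cos (2 * m * φ) : ℂ) • ψ - adjoint A v‖]

end Stability

/-! ### Robust oblivious amplification -/

section RobustAmplification

section

variable {α σ ι : Type} [Fintype α] [DecidableEq α] [Fintype σ] [DecidableEq σ] [Fintype ι]
  [DecidableEq ι]

theorem specNorm_of_mem_unitaryGroup {W : Matrix (Reg ι) (Reg ι) ℂ}
    (hW : W ∈ Matrix.unitaryGroup (Reg ι) ℂ) : specNorm W = 1 :=
  CStarRing.norm_of_mem_unitary (Unitary.map_mem (Matrix.toEuclideanCLM (𝕜 := ℂ)) hW)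

theorem IsBlockEncoding.error_nonneg {α δ : ℝ} {κ : Type} [Fintype κ] [DecidableEq κ]
    {V : Matrix (Reg (κ ⊕ σ)) (Reg (κ ⊕ σ)) ℂ} {W : Matrix (Reg σ) (Reg σ) ℂ}
    (hV : IsBlockEncoding α δ V W) : 0 ≤ δ :=
  (norm_nonneg _).trans hV.error_le

theorem IsBlockEncoding.pos_of_mem_unitaryGroup {c δ : ℝ}
    {V : Matrix (Reg (α ⊕ σ)) (Reg (α ⊕ σ)) ℂ} {W : Matrix (Reg σ) (Reg σ) ℂ}
    (hV : IsBlockEncoding c δ V W) (hW : W ∈ Matrix.unitaryGroup (Reg σ) ℂ) (hδ : δ < 1) :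
    0 < c := by
  refine hV.nonneg.lt_of_ne fun hc => ?_
  have h := hV.error_le
  rw [← hc, Complex.ofReal_zero, zero_smul, sub_zero, specNorm_of_mem_unitaryGroup hW] at h
  linarith

theorem norm_outputState_groverStep_pow_sub_sq_le {C : Matrix (Reg (α ⊕ σ)) (Reg (α ⊕ σ)) ℂ}
    (hC : C ∈ Matrix.unitaryGroup (Reg (α ⊕ σ)) ℂ) {W : Matrix (Reg σ) (Reg σ) ℂ}
    (hW : W ∈ Matrix.unitaryGroup (Reg σ) ℂ) {φ μ : ℝ}
    (hμ : specNorm (zeroBlock C - (Real.sin φ : ℂ) • W) ≤ μ) {ψ : QState σ} (hψ : ‖ψ‖ ≤ 1)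
    (m : ℕ) :
    (1 - specNorm (zeroBlock C) ^ 2) * ‖outputState (groverStep C ^ m * C) ψ -
      (Real.sin ((2 * m + 1) * φ) : ℂ) • applyOp W ψ‖ ^ 2 ≤ ((4 * m + 1) * μ) ^ 2 := by
  let T := Matrix.toEuclideanCLM (n := Reg σ) (𝕜 := ℂ)
  have hCC : C.conjTranspose * C = 1 := Matrix.mem_unitaryGroup_iff'.mp hC
  have hadjoint : T (zeroBlock C).conjTranspose =
      ContinuousLinearMap.adjoint (T (zeroBlock C)) := map_star T _
  have hμ' : ‖T (zeroBlock C) - (Real.sin φ : ℂ) • T W‖ ≤ μ := by rwa [← map_smul, ← map_sub]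
  rw [outputState_eq]
  refine norm_amplify_sub_sq_le (norm_applyOp_of_mem_unitaryGroup hW) hμ'
    (specNorm_zeroBlock_le_one hC) hψ
    (x := fun k => T (zeroBlock (C.conjTranspose * (groverStep C ^ k * C))) ψ)
    (y := fun k => T (zeroBlock (groverStep C ^ k * C)) ψ) ?_ ?_ (fun k => ?_) (fun k => ?_) m
  · simp [hCC, zeroBlock_one]
  · simp only [pow_zero, one_mul]
  · simp only [pow_succ', mul_assoc (groverStep C), zeroBlock_conjTranspose_mul_groverStep_mul hC,
      map_sub, map_smul, map_mul, hadjoint]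
    rfl
  · simp only [pow_succ', mul_assoc (groverStep C)]
    conv_lhs => rw [zeroBlock_groverStep_mul hC]
    simp only [map_add, map_smul, map_mul]
    rfl

end

/-- The angle for which `m` iterations of amplitude amplification reach amplitude one. -/
noncomputable def amplifyAngle (m : ℕ) : ℝ := Real.pi / (2 * (2 * m + 1))

theorem amplifyAngle_nonneg (m : ℕ) : 0 ≤ amplifyAngle m := by
  unfold amplifyAngle
  positivity

theorem mul_amplifyAngle (m : ℕ) : (2 * m + 1) * amplifyAngle m = Real.pi / 2 := by
  rw [amplifyAngle]
  field_simp

theorem sin_amplifyAngle_nonneg (m : ℕ) : 0 ≤ Real.sin (amplifyAngle m) :=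
  Real.sin_nonneg_of_nonneg_of_le_pi (amplifyAngle_nonneg m)
    (div_le_self Real.pi_pos.le (by linarith [(Nat.cast_nonneg m : (0 : ℝ) ≤ m)]))

theorem mul_sin_amplifyAngle_le (m : ℕ) :
    (2 * m + 1) * Real.sin (amplifyAngle m) ≤ Real.pi / 2 := by
  rw [← mul_amplifyAngle]
  gcongr
  exact Real.sin_le (amplifyAngle_nonneg m)

theorem sin_amplifyAngle_le_half {m : ℕ} (hm : 1 ≤ m) : Real.sin (amplifyAngle m) ≤ 1 / 2 := by
  have hm' : (1 : ℝ) ≤ m := by exact_mod_cast hm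
  rw [← Real.sin_pi_div_six]
  refine Real.sin_le_sin_of_le_of_le_pi_div_two ?_ (by linarith [Real.pi_pos]) ?_
  · linarith [amplifyAngle_nonneg m, Real.pi_pos]
  · exact div_le_div_of_nonneg_left Real.pi_pos.le (by norm_num) (by linarith)

theorem norm_outputState_groverStep_pow_sub_le {α σ : Type} [Fintype α] [DecidableEq α]
    [Fintype σ] [DecidableEq σ] {C : Matrix (Reg (α ⊕ σ)) (Reg (α ⊕ σ)) ℂ}
    (hC : C ∈ Matrix.unitaryGroup (Reg (α ⊕ σ)) ℂ) {W : Matrix (Reg σ) (Reg σ) ℂ}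
    (hW : W ∈ Matrix.unitaryGroup (Reg σ) ℂ) {m : ℕ} (hm : 1 ≤ m) {δ : ℝ} (hδ0 : 0 ≤ δ)
    (hδ : δ ≤ 1 / 8)
    (herror : specNorm (zeroBlock C - (Real.sin (amplifyAngle m) : ℂ) • W) ≤
      Real.sin (amplifyAngle m) * δ) {ψ : QState σ} (hψ : ‖ψ‖ ≤ 1) :
    ‖outputState (groverStep C ^ m * C) ψ - applyOp W ψ‖ ≤ 4 * δ := by
  have hsin0 := sin_amplifyAngle_nonneg m
  have hsin := sin_amplifyAngle_le_half hm
  have hstable := norm_outputState_groverStep_pow_sub_sq_le hC hW herror hψ m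
  rw [mul_amplifyAngle, Real.sin_pi_div_two, Complex.ofReal_one, one_smul] at hstable
  have hblock : specNorm (zeroBlock C) ≤ 9 / 16 := by
    have h := norm_le_norm_sub_add (Matrix.toEuclideanCLM (𝕜 := ℂ) (zeroBlock C))
      (Matrix.toEuclideanCLM (𝕜 := ℂ) ((Real.sin (amplifyAngle m) : ℂ) • W))
    rw [← map_sub, map_smul, norm_smul, Complex.norm_real, Real.norm_eq_abs,
      abs_of_nonneg hsin0] at h
    have hW1 := specNorm_of_mem_unitaryGroup hW
    rw [specNorm] at hW1 herror ⊢
    nlinarith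
  have hblock' : specNorm (zeroBlock C) ^ 2 ≤ (9 / 16) ^ 2 :=
    pow_le_pow_left₀ (norm_nonneg _) hblock 2
  have hgrow : (4 * m + 1) * (Real.sin (amplifyAngle m) * δ) ≤ 3.15 * δ := by
    have hpi := Real.pi_lt_d2
    have h := mul_sin_amplifyAngle_le m
    rw [← mul_assoc]
    gcongr
    linarith
  have hgrow' := pow_le_pow_left₀ (by positivity) hgrow 2
  refine abs_le_of_sq_le_sq' ?_ (by positivity) |>.2
  nlinarith [sq_nonneg ‖outputState (groverStep C ^ m * C) ψ - applyOp W ψ‖]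

/-- The damping that turns the sub-normalization `α` into `1 / sin (amplifyAngle ⌈α⌉₊)`, so that
`⌈α⌉₊` iterations amplify to amplitude one. -/
noncomputable def dampAngle (α : ℝ) : ℝ := Real.arccos (α * Real.sin (amplifyAngle ⌈α⌉₊))

theorem cos_dampAngle {α : ℝ} (hα : 0 ≤ α) :
    Real.cos (dampAngle α) = α * Real.sin (amplifyAngle ⌈α⌉₊) := by
  have hsin := sin_amplifyAngle_nonneg ⌈α⌉₊
  have hle := mul_sin_amplifyAngle_le ⌈α⌉₊
  have hceil := mul_le_mul_of_nonneg_right (Nat.le_ceil α) hsin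
  refine Real.cos_arccos ((by norm_num : (-1 : ℝ) ≤ 0).trans (mul_nonneg hα hsin)) ?_
  linarith [Real.pi_le_four]

variable {b a s : ℕ} {U : Matrix (Reg (Fin a ⊕ Fin s)) (Reg (Fin a ⊕ Fin s)) ℂ}

theorem IsBlockEncoding.specNorm_zeroBlock_damp_sub_le {V : Circuit b a}
    {W : Matrix (Reg (Fin s)) (Reg (Fin s)) ℂ} {α δ : ℝ}
    (hV : IsBlockEncoding α δ (V.eval U) W) :
    specNorm (zeroBlock ((V.damp (dampAngle α)).eval U) -
      (Real.sin (amplifyAngle ⌈α⌉₊) : ℂ) • W) ≤ Real.sin (amplifyAngle ⌈α⌉₊) * δ := by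
  have hsub : zeroBlock ((V.damp (dampAngle α)).eval U) -
      (Real.sin (amplifyAngle ⌈α⌉₊) : ℂ) • W =
      (-Real.sin (amplifyAngle ⌈α⌉₊) : ℂ) • (W - (α : ℂ) • zeroBlock (V.eval U)) := by
    rw [Circuit.zeroBlock_eval_damp, cos_dampAngle hV.nonneg, Complex.ofReal_mul]
    module
  rw [hsub, specNorm, map_smul, norm_smul, norm_neg, Complex.norm_real, Real.norm_eq_abs,
    abs_of_nonneg (sin_amplifyAngle_nonneg _)]
  exact mul_le_mul_of_nonneg_left hV.error_le (sin_amplifyAngle_nonneg _)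

theorem IsBlockEncoding.norm_outputState_amplify_sub_le_four_mul
    (hU : U ∈ Matrix.unitaryGroup (Reg (Fin a ⊕ Fin s)) ℂ) {V : Circuit b a}
    {W : Matrix (Reg (Fin s)) (Reg (Fin s)) ℂ} (hW : W ∈ Matrix.unitaryGroup (Reg (Fin s)) ℂ)
    {α δ : ℝ} (hV : IsBlockEncoding α δ (V.eval U) W) (hδ : δ ≤ 1 / 8) {ψ : QState (Fin s)}
    (hψ : ‖ψ‖ ≤ 1) :
    ‖outputState (((V.damp (dampAngle α)).amplify ⌈α⌉₊).eval U) ψ - applyOp W ψ‖ ≤ 4 * δ := by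
  rw [Circuit.eval_amplify]
  exact norm_outputState_groverStep_pow_sub_le (Circuit.eval_mem_unitaryGroup hU _) hW
    (Nat.one_le_ceil_iff.mpr (hV.pos_of_mem_unitaryGroup hW (by linarith))) hV.error_nonneg hδ
    hV.specNorm_zeroBlock_damp_sub_le hψ

theorem IsBlockEncoding.norm_outputState_amplify_sub_le_sixteen_mul
    (hU : U ∈ Matrix.unitaryGroup (Reg (Fin a ⊕ Fin s)) ℂ) {V : Circuit b a}
    {W : Matrix (Reg (Fin s)) (Reg (Fin s)) ℂ} (hW : W ∈ Matrix.unitaryGroup (Reg (Fin s)) ℂ)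
    {α δ : ℝ} (hV : IsBlockEncoding α δ (V.eval U) W) {ψ : QState (Fin s)} (hψ : ‖ψ‖ ≤ 1) :
    ‖outputState (((V.damp (dampAngle α)).amplify ⌈α⌉₊).eval U) ψ - applyOp W ψ‖ ≤ 16 * δ := by
  rcases le_or_gt δ (1 / 8) with hδ | hδ
  · linarith [hV.norm_outputState_amplify_sub_le_four_mul hU hW hδ hψ, hV.error_nonneg]
  · have hout := norm_outputState_le (Circuit.eval_mem_unitaryGroup hU
      ((V.damp (dampAngle α)).amplify ⌈α⌉₊)) ψ
    have htarget := norm_applyOp_of_mem_unitaryGroup hW ψ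
    have htriangle := norm_sub_le
      (outputState (((V.damp (dampAngle α)).amplify ⌈α⌉₊).eval U) ψ) (applyOp W ψ)
    linarith

end RobustAmplification

/-! ### Polynomials on the unit circle -/

section CirclePolynomials

open Polynomial

theorem mul_conj_eq_norm_sq (z : ℂ) : z * starRingEnd ℂ z = ((‖z‖ ^ 2 : ℝ) : ℂ) := by
  rw [Complex.mul_conj, Complex.normSq_eq_norm_sq]

theorem mul_conj_eq_one_of_norm_eq_one {w : ℂ} (hw : ‖w‖ = 1) : w * starRingEnd ℂ w = 1 := by
  rw [mul_conj_eq_norm_sq, hw, one_pow, Complex.ofReal_one]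

theorem ne_zero_of_norm_eq_one {w : ℂ} (hw : ‖w‖ = 1) : w ≠ 0 :=
  norm_ne_zero_iff.mp (hw ▸ one_ne_zero)

theorem eq_of_eval_eq_on_circle {p q : ℂ[X]} (h : ∀ w : ℂ, ‖w‖ = 1 → p.eval w = q.eval w) :
    p = q := by
  have hinf : (Metric.sphere (0 : ℂ) 1).Infinite := by
    refine (isPreconnected_sphere ?_ 0 1).infinite_of_nontrivial ⟨1, by simp, -1, by simp, ?_⟩
    · rw [← Module.finrank_eq_rank ℝ ℂ]
      simp
    · norm_num
  exact eq_of_infinite_eval_eq p q (hinf.mono fun w hw => h w (by simpa using hw))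

/-- The reciprocal conjugate `X ^ N * conj (f (1 / conj X))` of a polynomial of degree at most
`N`; on the unit circle it takes the value `w ^ N * conj (f w)`. -/
noncomputable def conjReflect (N : ℕ) (f : ℂ[X]) : ℂ[X] := (f.map (starRingEnd ℂ)).reflect N

theorem coeff_zero_conjReflect (N : ℕ) (f : ℂ[X]) :
    (conjReflect N f).coeff 0 = starRingEnd ℂ (f.coeff N) := by
  rw [conjReflect, coeff_reflect, revAt_le (Nat.zero_le N), coeff_map, Nat.sub_zero]

theorem coeff_conjReflect_self (N : ℕ) (f : ℂ[X]) :
    (conjReflect N f).coeff N = starRingEnd ℂ (f.coeff 0) := by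
  rw [conjReflect, coeff_reflect, revAt_le le_rfl, coeff_map, Nat.sub_self]

theorem natDegree_conjReflect_le {N : ℕ} {f : ℂ[X]} (hf : f.natDegree ≤ N) :
    (conjReflect N f).natDegree ≤ N :=
  (natDegree_reflect_le ..).trans (max_le le_rfl (natDegree_map_le.trans hf))

theorem eval_conjReflect {N : ℕ} {f : ℂ[X]} (hf : f.natDegree ≤ N) {w : ℂ} (hw : w ≠ 0) :
    (conjReflect N f).eval w = w ^ N * starRingEnd ℂ (f.eval (starRingEnd ℂ w)⁻¹) := by
  let _ : Invertible w⁻¹ := invertibleOfNonzero (inv_ne_zero hw)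
  have hreflect : (conjReflect N f).eval w * w⁻¹ ^ N = (f.map (starRingEnd ℂ)).eval w⁻¹ := by
    simpa only [conjReflect, invOf_eq_inv, inv_inv, eval₂_id] using
      eval₂_reflect_mul_pow (RingHom.id ℂ) w⁻¹ N (f.map (starRingEnd ℂ)) (natDegree_map_le.trans hf)
  have hconj : (f.map (starRingEnd ℂ)).eval w⁻¹ = starRingEnd ℂ (f.eval (starRingEnd ℂ w)⁻¹) := by
    rw [eval_map, ← eval₂_hom, map_inv₀, Complex.conj_conj]
  rw [← hconj, ← hreflect, mul_left_comm, ← mul_pow, mul_inv_cancel₀ hw, one_pow, mul_one]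

theorem eval_conjReflect_of_norm_eq_one {N : ℕ} {f : ℂ[X]} (hf : f.natDegree ≤ N) {w : ℂ}
    (hw : ‖w‖ = 1) : (conjReflect N f).eval w = w ^ N * starRingEnd ℂ (f.eval w) := by
  rw [eval_conjReflect hf (ne_zero_of_norm_eq_one hw),
    ← eq_inv_of_mul_eq_one_left (mul_conj_eq_one_of_norm_eq_one hw)]

/-- `F` is `X ^ d` times a Laurent polynomial of degree at most `d` that is positive on the unit
circle. -/
structure IsPositiveOnCircle (d : ℕ) (F : ℂ[X]) : Prop where
  natDegree_le : F.natDegree ≤ 2 * d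
  exists_pos : ∀ w : ℂ, ‖w‖ = 1 → ∃ r : ℝ, 0 < r ∧ F.eval w = r * w ^ d

namespace IsPositiveOnCircle

variable {d : ℕ} {F : ℂ[X]}

theorem conjReflect_eq (hF : IsPositiveOnCircle d F) : conjReflect (2 * d) F = F := by
  refine eq_of_eval_eq_on_circle fun w hw => ?_
  obtain ⟨r, -, h⟩ := hF.exists_pos w hw
  rw [eval_conjReflect_of_norm_eq_one hF.natDegree_le hw, h, map_mul, map_pow, Complex.conj_ofReal]
  calc w ^ (2 * d) * (r * starRingEnd ℂ w ^ d)
      = r * w ^ d * (w * starRingEnd ℂ w) ^ d := by ring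
    _ = r * w ^ d := by rw [mul_conj_eq_one_of_norm_eq_one hw, one_pow, mul_one]

theorem eval_ne_zero (hF : IsPositiveOnCircle d F) {w : ℂ} (hw : ‖w‖ = 1) : F.eval w ≠ 0 := by
  obtain ⟨r, hr, h⟩ := hF.exists_pos w hw
  rw [h]
  exact mul_ne_zero (Complex.ofReal_ne_zero.mpr hr.ne') (pow_ne_zero _ (ne_zero_of_norm_eq_one hw))

theorem coeff_two_mul (hF : IsPositiveOnCircle d F) :
    F.coeff (2 * d) = starRingEnd ℂ (F.coeff 0) := by
  conv_lhs => rw [← hF.conjReflect_eq, coeff_conjReflect_self]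

theorem isRoot_inv_conj (hF : IsPositiveOnCircle d F) {r : ℂ} (hr : F.IsRoot r) (hr0 : r ≠ 0) :
    F.IsRoot (starRingEnd ℂ r)⁻¹ := by
  rw [IsRoot.def, ← hF.conjReflect_eq, eval_conjReflect hF.natDegree_le
    (inv_ne_zero ((_root_.map_ne_zero _).mpr hr0)), map_inv₀, Complex.conj_conj, inv_inv, hr,
    map_zero, mul_zero]

theorem inv_conj_ne_of_isRoot (hF : IsPositiveOnCircle d F) {r : ℂ} (hr : F.IsRoot r)
    (hr0 : r ≠ 0) : r ≠ (starRingEnd ℂ r)⁻¹ := by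
  intro h
  have hnorm : ((‖r‖ ^ 2 : ℝ) : ℂ) = 1 := by
    rw [← mul_conj_eq_norm_sq]
    nth_rewrite 1 [h]
    exact inv_mul_cancel₀ ((_root_.map_ne_zero _).mpr hr0)
  exact hF.eval_ne_zero ((pow_eq_one_iff_of_nonneg (norm_nonneg r) two_ne_zero).mp
    (by exact_mod_cast hnorm)) hr

theorem exists_eq_X_mul (hF : IsPositiveOnCircle (d + 1) F) (h0 : F.coeff 0 = 0) :
    ∃ G : ℂ[X], G.natDegree ≤ 2 * d ∧ F = X * G := by
  obtain ⟨G, rfl⟩ := X_dvd_iff.mpr h0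
  refine ⟨G, natDegree_le_iff_coeff_eq_zero.mpr fun n hn => ?_, rfl⟩
  rw [← coeff_X_mul]
  rcases Nat.lt_or_ge (2 * (d + 1)) (n + 1) with h | h
  · exact coeff_eq_zero_of_natDegree_lt (hF.natDegree_le.trans_lt h)
  · rw [show n + 1 = 2 * (d + 1) by lia, hF.coeff_two_mul, h0, map_zero]

theorem exists_eq_X_sub_C_mul (hF : IsPositiveOnCircle (d + 1) F) (h0 : F.coeff 0 ≠ 0) :
    ∃ (r : ℂ) (G : ℂ[X]), r ≠ 0 ∧ G.natDegree ≤ 2 * d ∧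
      F = (X - C r) * (X - C (starRingEnd ℂ r)⁻¹) * G := by
  have hdeg : F.natDegree = 2 * (d + 1) := by
    refine le_antisymm hF.natDegree_le (le_natDegree_of_ne_zero ?_)
    rw [hF.coeff_two_mul]
    exact (_root_.map_ne_zero _).mpr h0
  obtain ⟨r, hr⟩ := Complex.exists_root (f := F) (by
    rw [← natDegree_pos_iff_degree_pos, hdeg]
    lia)
  have hr0 : r ≠ 0 := by
    rintro rfl
    exact h0 (by rw [coeff_zero_eq_eval_zero, hr])
  have hcoprime : IsCoprime (X - C r) (X - C (starRingEnd ℂ r)⁻¹) :=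
    isCoprime_X_sub_C_of_isUnit_sub (sub_ne_zero.mpr (hF.inv_conj_ne_of_isRoot hr hr0)).isUnit
  obtain ⟨G, rfl⟩ := hcoprime.mul_dvd (dvd_iff_isRoot.mpr hr)
    (dvd_iff_isRoot.mpr (hF.isRoot_inv_conj hr hr0))
  refine ⟨r, G, hr0, ?_, rfl⟩
  have hmonic : ((X - C r) * (X - C (starRingEnd ℂ r)⁻¹)).Monic :=
    (monic_X_sub_C _).mul (monic_X_sub_C _)
  have hG : G ≠ 0 := by
    rintro rfl
    simp at h0
  rw [hmonic.natDegree_mul' hG, (monic_X_sub_C _).natDegree_mul (monic_X_sub_C _),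
    natDegree_X_sub_C, natDegree_X_sub_C] at hdeg
  lia

/-- Roots off the circle come in pairs `r`, `1 / conj r`, and the two linear factors of a pair have
the product `‖w - r‖ ^ 2 * w` on the circle, up to a constant. -/
theorem exists_eval_eq_mul (hF : IsPositiveOnCircle (d + 1) F) :
    ∃ (r : ℂ) (G : ℂ[X]), G.natDegree ≤ 2 * d ∧
      ∀ w : ℂ, ‖w‖ = 1 → F.eval w = ((‖w - r‖ ^ 2 : ℝ) : ℂ) * w * G.eval w := by
  by_cases h0 : F.coeff 0 = 0
  · obtain ⟨G, hG, rfl⟩ := hF.exists_eq_X_mul h0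
    exact ⟨0, G, hG, fun w hw => by simp [hw]⟩
  · obtain ⟨r, G, hr0, hG, rfl⟩ := hF.exists_eq_X_sub_C_mul h0
    refine ⟨r, C (-(starRingEnd ℂ r)⁻¹) * G, (natDegree_C_mul_le _ _).trans hG, fun w hw => ?_⟩
    have hrc : starRingEnd ℂ r ≠ 0 := (_root_.map_ne_zero _).mpr hr0
    rw [← mul_conj_eq_norm_sq, map_sub]
    simp only [eval_mul, eval_sub, eval_X, eval_C]
    field_simp
    linear_combination ((w - r) * eval w G) * mul_conj_eq_one_of_norm_eq_one hw

theorem of_eval_eq_mul (hF : IsPositiveOnCircle (d + 1) F) {r : ℂ} {G : ℂ[X]}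
    (hG : G.natDegree ≤ 2 * d)
    (h : ∀ w : ℂ, ‖w‖ = 1 → F.eval w = ((‖w - r‖ ^ 2 : ℝ) : ℂ) * w * G.eval w) :
    IsPositiveOnCircle d G := by
  refine ⟨hG, fun w hw => ?_⟩
  obtain ⟨t, ht, he⟩ := hF.exists_pos w hw
  have hfactor : ((‖w - r‖ ^ 2 : ℝ) : ℂ) * w ≠ 0 := fun h0 =>
    hF.eval_ne_zero hw (by rw [h w hw, h0, zero_mul])
  have hpos : 0 < ‖w - r‖ ^ 2 :=
    (sq_nonneg _).lt_of_ne' (Complex.ofReal_ne_zero.mp (left_ne_zero_of_mul hfactor))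
  refine ⟨t / ‖w - r‖ ^ 2, div_pos ht hpos, mul_left_cancel₀ hfactor ?_⟩
  have hne := left_ne_zero_of_mul hfactor
  rw [← h w hw, he, Complex.ofReal_div]
  field_simp
  ring

/-- The **Fejér–Riesz theorem**, by induction on the number of pairs of roots. -/
theorem exists_eval_eq_norm_sq (hF : IsPositiveOnCircle d F) :
    ∃ Q : ℂ[X], Q.natDegree ≤ d ∧
      ∀ w : ℂ, ‖w‖ = 1 → F.eval w = ((‖Q.eval w‖ ^ 2 : ℝ) : ℂ) * w ^ d := by
  induction d generalizing F with
  | zero =>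
    obtain ⟨c, rfl⟩ := natDegree_eq_zero.mp (Nat.le_zero.mp hF.natDegree_le)
    obtain ⟨r, hr, h1⟩ := hF.exists_pos 1 norm_one
    simp only [eval_C, pow_zero, mul_one] at h1
    refine ⟨C ((√r : ℝ) : ℂ), by simp, fun w _ => ?_⟩
    rw [eval_C, eval_C, h1, Complex.norm_real, Real.norm_eq_abs, sq_abs, Real.sq_sqrt hr.le,
      pow_zero, mul_one]
  | succ d ih =>
    obtain ⟨r, G, hG, h⟩ := hF.exists_eval_eq_mul
    obtain ⟨Q, hQ, hQe⟩ := ih (hF.of_eval_eq_mul hG h)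
    refine ⟨(X - C r) * Q, ?_, fun w hw => ?_⟩
    · refine natDegree_mul_le.trans ?_
      rw [natDegree_X_sub_C]
      lia
    · rw [h w hw, hQe w hw, eval_mul, norm_mul, mul_pow]
      simp only [eval_sub, eval_X, eval_C, Complex.ofReal_mul]
      ring

end IsPositiveOnCircle

theorem exists_norm_sq_add_norm_sq_eq_one {d : ℕ} {P : ℂ[X]} (hP : P.natDegree ≤ d)
    (hlt : ∀ w : ℂ, ‖w‖ = 1 → ‖P.eval w‖ < 1) :
    ∃ Q : ℂ[X], Q.natDegree ≤ d ∧ ∀ w : ℂ, ‖w‖ = 1 → ‖P.eval w‖ ^ 2 + ‖Q.eval w‖ ^ 2 = 1 := by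
  have heval : ∀ w : ℂ, ‖w‖ = 1 → (X ^ d - P * conjReflect d P).eval w =
      ((1 - ‖P.eval w‖ ^ 2 : ℝ) : ℂ) * w ^ d := by
    intro w hw
    rw [Complex.ofReal_sub, ← mul_conj_eq_norm_sq, eval_sub, eval_mul, eval_pow, eval_X,
      eval_conjReflect_of_norm_eq_one hP hw, Complex.ofReal_one]
    ring
  have hpos : IsPositiveOnCircle d (X ^ d - P * conjReflect d P) := by
    refine ⟨?_, fun w hw => ⟨_, ?_, heval w hw⟩⟩
    · refine (natDegree_sub_le _ _).trans (max_le ?_ (natDegree_mul_le.trans ?_))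
      · rw [natDegree_X_pow]
        lia
      · have := natDegree_conjReflect_le hP
        lia
    · exact sub_pos.mpr (pow_lt_one₀ (norm_nonneg _) (hlt w hw) two_ne_zero)
  obtain ⟨Q, hQ, hQe⟩ := hpos.exists_eval_eq_norm_sq
  refine ⟨Q, hQ, fun w hw => ?_⟩
  have hsq : (1 - ‖P.eval w‖ ^ 2 : ℝ) = ‖Q.eval w‖ ^ 2 := Complex.ofReal_injective
    (mul_right_cancel₀ (pow_ne_zero d (ne_zero_of_norm_eq_one hw))
      ((heval w hw).symm.trans (hQe w hw)))
  linarith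

end CirclePolynomials

/-! ### Unit vectors of polynomials -/

section UnitPolyVectors

open Polynomial Matrix
open scoped ComplexOrder

variable {ι : Type*} [Fintype ι]

theorem star_mulVec_dotProduct_mulVec [DecidableEq ι] (u : unitaryGroup ι ℂ) (v : ι → ℂ) :
    star ((u : Matrix ι ι ℂ) *ᵥ v) ⬝ᵥ ((u : Matrix ι ι ℂ) *ᵥ v) = star v ⬝ᵥ v := by
  rw [star_mulVec, dotProduct_mulVec, vecMul_vecMul, ← star_eq_conjTranspose,
    mem_unitaryGroup_iff'.mp u.2, vecMul_one]

theorem exists_unit_smul_eq {x : ι → ℂ} (hx : x ≠ 0) :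
    ∃ (c : ι → ℂ) (r : ℂ), star c ⬝ᵥ c = 1 ∧ r ≠ 0 ∧ x = r • c := by
  have hnorm : star x ⬝ᵥ x = ((∑ i, ‖x i‖ ^ 2 : ℝ) : ℂ) := by
    rw [Complex.ofReal_sum]
    exact Finset.sum_congr rfl fun i _ => (mul_comm _ _).trans (mul_conj_eq_norm_sq _)
  set n := ∑ i, ‖x i‖ ^ 2
  have hn : n ≠ 0 := by
    rw [← Complex.ofReal_ne_zero, ← hnorm]
    exact dotProduct_star_self_eq_zero.not.mpr hx
  have hn0 : 0 ≤ n := Finset.sum_nonneg fun i _ => sq_nonneg _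
  have hr : ((√n : ℝ) : ℂ) ≠ 0 :=
    Complex.ofReal_ne_zero.mpr (Real.sqrt_ne_zero'.mpr (hn0.lt_of_ne' hn))
  refine ⟨((√n : ℝ) : ℂ)⁻¹ • x, (√n : ℝ), ?_, hr, (smul_inv_smul₀ hr x).symm⟩
  rw [star_smul, smul_dotProduct, dotProduct_smul, hnorm, smul_eq_mul, smul_eq_mul, star_inv₀,
    Complex.star_def, Complex.conj_ofReal]
  nth_rewrite 3 [← Real.mul_self_sqrt hn0]
  rw [Complex.ofReal_mul]
  field_simp

theorem exists_unit_dotProduct_eq_zero (v : Fin 2 → ℂ) :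
    ∃ c : Fin 2 → ℂ, star c ⬝ᵥ c = 1 ∧ star c ⬝ᵥ v = 0 := by
  by_cases hv : v = 0
  · exact ⟨![1, 0], by simp [dotProduct], by simp [hv]⟩
  · obtain ⟨c, r, hc, -, rfl⟩ := exists_unit_smul_eq hv
    refine ⟨![-star (c 1), star (c 0)], ?_, ?_⟩
    · simp only [dotProduct, Fin.sum_univ_two, Pi.star_apply, cons_val_zero, cons_val_one, star_neg,
        star_star] at hc ⊢
      linear_combination hc
    · simp only [dotProduct, Fin.sum_univ_two, Pi.star_apply, cons_val_zero, cons_val_one, star_neg,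
        star_star, Pi.smul_apply, smul_eq_mul]
      ring

theorem exists_unit_of_dotProduct_eq_zero {v t : Fin 2 → ℂ} (h : star t ⬝ᵥ v = 0) :
    ∃ c : Fin 2 → ℂ, star c ⬝ᵥ c = 1 ∧ star c ⬝ᵥ v = 0 ∧ c 0 * t 1 = c 1 * t 0 := by
  by_cases ht : t = 0
  · obtain ⟨c, hc, hcv⟩ := exists_unit_dotProduct_eq_zero v
    exact ⟨c, hc, hcv, by simp [ht]⟩
  · obtain ⟨c, r, hc, hr, rfl⟩ := exists_unit_smul_eq ht
    rw [star_smul, smul_dotProduct] at h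
    refine ⟨c, hc, (smul_eq_zero.mp h).resolve_left (star_ne_zero.mpr hr), ?_⟩
    simp only [Pi.smul_apply, smul_eq_mul]
    ring

/-- The special unitary matrix with a given unit vector as its first column. -/
def unitaryOfColumn (c : Fin 2 → ℂ) (hc : star c ⬝ᵥ c = 1) : unitaryGroup (Fin 2) ℂ :=
  ⟨!![c 0, -star (c 1); c 1, star (c 0)], by
    rw [mem_unitaryGroup_iff]
    ext i j
    fin_cases i <;> fin_cases j
    · simpa [dotProduct, Matrix.mul_apply, Matrix.star_apply, mul_comm] using hc
    · simp [Matrix.mul_apply, Matrix.star_apply, mul_comm]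
    · simp [Matrix.mul_apply, Matrix.star_apply, mul_comm]
    · simpa [dotProduct, Matrix.mul_apply, Matrix.star_apply, mul_comm, add_comm] using hc⟩

/-- Vectors of polynomials of degree at most `d` that are unit vectors at every point of the unit
circle. -/
structure IsUnitPolyVector (d : ℕ) (f : ι → ℂ[X]) : Prop where
  natDegree_le : ∀ i, (f i).natDegree ≤ d
  dotProduct_eq : ∀ w : ℂ, ‖w‖ = 1 →
    (star fun i => (f i).eval w) ⬝ᵥ (fun i => (f i).eval w) = 1

namespace IsUnitPolyVector

variable {d : ℕ}

theorem coeff_dotProduct_coeff_zero {f : ι → ℂ[X]} (hf : IsUnitPolyVector (d + 1) f) :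
    (star fun i => (f i).coeff (d + 1)) ⬝ᵥ (fun i => (f i).coeff 0) = 0 := by
  have hsum : ∑ i, conjReflect (d + 1) (f i) * f i = X ^ (d + 1) := by
    refine eq_of_eval_eq_on_circle fun w hw => ?_
    rw [eval_finsetSum, eval_pow, eval_X, ← mul_one (w ^ (d + 1)), ← hf.dotProduct_eq w hw,
      dotProduct, Finset.mul_sum]
    refine Finset.sum_congr rfl fun i _ => ?_
    rw [eval_mul, eval_conjReflect_of_norm_eq_one (hf.natDegree_le i) hw, mul_assoc]
    rfl
  have h0 := congrArg (fun p : ℂ[X] => p.coeff 0) hsum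
  simpa [dotProduct, finsetSum_coeff, mul_coeff_zero, coeff_zero_conjReflect, coeff_X_pow] using h0

theorem mulVec [DecidableEq ι] {f : ι → ℂ[X]} (hf : IsUnitPolyVector d f)
    (u : unitaryGroup ι ℂ) : IsUnitPolyVector d ((u : Matrix ι ι ℂ).map C *ᵥ f) where
  natDegree_le i := natDegree_sum_le_of_forall_le _ _ fun j _ =>
    (natDegree_C_mul_le _ _).trans (hf.natDegree_le j)
  dotProduct_eq w hw := by
    have heval : (fun i => (((u : Matrix ι ι ℂ).map C *ᵥ f) i).eval w) =
        (u : Matrix ι ι ℂ) *ᵥ fun i => (f i).eval w := by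
      funext i
      simp [Matrix.mulVec, dotProduct, eval_finsetSum]
    rw [heval, star_mulVec_dotProduct_mulVec, hf.dotProduct_eq w hw]

theorem of_X_mul {p q : ℂ[X]} (hf : IsUnitPolyVector (d + 1) ![X * p, q])
    (hq : q.coeff (d + 1) = 0) : IsUnitPolyVector d ![p, q] where
  natDegree_le := by
    refine Fin.forall_fin_two.mpr ⟨?_, natDegree_le_iff_coeff_eq_zero.mpr fun n hn => ?_⟩
    · by_cases hp : p = 0
      · simp [hp]
      · have h := hf.natDegree_le 0
        rw [cons_val_zero, natDegree_X_mul hp] at h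
        exact Nat.succ_le_succ_iff.mp h
    · rcases Nat.lt_or_ge (d + 1) n with h | h
      · exact coeff_eq_zero_of_natDegree_lt ((hf.natDegree_le 1).trans_lt h)
      · obtain rfl : n = d + 1 := by lia
        exact hq
  dotProduct_eq w hw := by
    have h := hf.dotProduct_eq w hw
    simp only [dotProduct, Fin.sum_univ_two, Pi.star_apply, cons_val_zero, cons_val_one, eval_mul,
      eval_X, star_mul'] at h ⊢
    have hw' : w * star w = 1 := mul_conj_eq_one_of_norm_eq_one hw
    linear_combination h - star (eval w p) * eval w p * hw'

theorem exists_eq_C {f : Fin 2 → ℂ[X]} (hf : IsUnitPolyVector 0 f) :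
    ∃ u : unitaryGroup (Fin 2) ℂ, ∀ i, f i = C (u.1 i 0) := by
  have hconst : ∀ i, f i = C ((f i).coeff 0) := fun i =>
    eq_C_of_natDegree_le_zero (hf.natDegree_le i)
  refine ⟨unitaryOfColumn (fun i => (f i).coeff 0) ?_, fun i => ?_⟩
  · have h := hf.dotProduct_eq 1 norm_one
    have heval : (fun i => (f i).eval 1) = fun i => (f i).coeff 0 := by
      funext i
      rw [hconst i, eval_C, coeff_C_zero]
    rwa [heval] at h
  · fin_cases i
    · exact hconst 0
    · exact hconst 1

/-- The lowest and the highest coefficient vectors are orthogonal, so a rotation makes the first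
entry divisible by `X` and lowers the degree of the second one. -/
theorem exists_eq_mulVec {f : Fin 2 → ℂ[X]} (hf : IsUnitPolyVector (d + 1) f) :
    ∃ (u : unitaryGroup (Fin 2) ℂ) (g : Fin 2 → ℂ[X]), IsUnitPolyVector d g ∧
      f = u.1.map C *ᵥ ![X * g 0, g 1] := by
  obtain ⟨c, hc, hlow, hhigh⟩ := exists_unit_of_dotProduct_eq_zero hf.coeff_dotProduct_coeff_zero
  set u := unitaryOfColumn c hc
  set f' := (star u : unitaryGroup (Fin 2) ℂ).1.map C *ᵥ f with hf'
  have hcoeff : ∀ i n, (f' i).coeff n = star (u.1 0 i) * (f 0).coeff n +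
      star (u.1 1 i) * (f 1).coeff n := fun i n => by
    fin_cases i <;> simp [hf']
  have hzero : (f' 0).coeff 0 = 0 := by
    rw [hcoeff, ← hlow, dotProduct, Fin.sum_univ_two]
    rfl
  have htop : (f' 1).coeff (d + 1) = 0 := by
    rw [hcoeff]
    simp only [u, unitaryOfColumn, of_apply, cons_val', cons_val_zero, cons_val_one,
      cons_val_fin_one, star_neg, star_star]
    linear_combination hhigh
  obtain ⟨g₀, hg₀⟩ := X_dvd_iff.mpr hzero
  have hpair : f' = ![X * g₀, f' 1] := by
    funext i
    fin_cases i
    · exact hg₀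
    · rfl
  refine ⟨u, ![g₀, f' 1], of_X_mul (hpair ▸ hf.mulVec (star u)) htop, ?_⟩
  change f = u.1.map C *ᵥ ![X * g₀, f' 1]
  rw [← hpair, hf', mulVec_mulVec, ← Matrix.map_mul]
  simp

end IsUnitPolyVector

theorem exists_isUnitPolyVector_of_norm_lt_one {d : ℕ} {P : ℂ[X]} (hP : P.natDegree ≤ d)
    (hlt : ∀ w : ℂ, ‖w‖ = 1 → ‖P.eval w‖ < 1) : ∃ Q : ℂ[X], IsUnitPolyVector d ![P, Q] := by
  obtain ⟨Q, hQ, hPQ⟩ := exists_norm_sq_add_norm_sq_eq_one hP hlt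
  refine ⟨Q, Fin.forall_fin_two.mpr ⟨hP, hQ⟩, fun w hw => ?_⟩
  have h := congrArg Complex.ofReal (hPQ w hw)
  rw [Complex.ofReal_add, ← mul_conj_eq_norm_sq, ← mul_conj_eq_norm_sq, Complex.ofReal_one] at h
  simp only [dotProduct, Fin.sum_univ_two, Pi.star_apply, cons_val_zero, cons_val_one,
    Complex.star_def]
  linear_combination h

end UnitPolyVectors

/-! ### Branches of the work register -/

section Branches

variable {b a s : ℕ}

/-- The basis state with work qubits `ω` and the remaining qubits in the state `x`. -/
def joinWork (ω : Reg (Fin b)) (x : Reg (Fin a ⊕ Fin s)) : Reg (Wires b a s) :=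
  Sum.elim (Sum.elim ω fun j => x (Sum.inl j)) fun j => x (Sum.inr j)

/-- The operator that acts on the qubits outside the work register when the work register starts in
`0` and is found in `ω`. -/
def branch (M : Matrix (Reg (Wires b a s)) (Reg (Wires b a s)) ℂ) (ω : Reg (Fin b)) :
    Matrix (Reg (Fin a ⊕ Fin s)) (Reg (Fin a ⊕ Fin s)) ℂ :=
  Matrix.of fun x y => M (joinWork ω x) (joinWork 0 y)

theorem zeroBlock_branch_zero (M : Matrix (Reg (Wires b a s)) (Reg (Wires b a s)) ℂ) :
    zeroBlock (branch M 0) = zeroBlock M := by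
  have h (x : Reg (Fin s)) : joinWork (0 : Reg (Fin b)) (Sum.elim (fun _ : Fin a => 0) x) =
      Sum.elim (fun _ => 0) x := by
    funext k
    rcases k with (k | k) | k <;> rfl
  ext x y
  simp only [zeroBlock, branch, Matrix.of_apply, h]

theorem joinWork_injective : Function.Injective2 (joinWork (b := b) (a := a) (s := s)) := by
  intro ω ω' x x' h
  refine ⟨funext fun q => congrFun h (Sum.inl (Sum.inl q)), funext fun k => ?_⟩
  rcases k with k | k
  · exact congrFun h (Sum.inl (Sum.inr k))
  · exact congrFun h (Sum.inr k)

theorem branch_one (ω : Reg (Fin b)) :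
    branch (1 : Matrix (Reg (Wires b a s)) (Reg (Wires b a s)) ℂ) ω = if ω = 0 then 1 else 0 := by
  ext x y
  simp only [branch, Matrix.of_apply, Matrix.one_apply, joinWork_injective.eq_iff]
  by_cases h : ω = 0
  · simp [h, Matrix.one_apply]
  · simp [h]

theorem joinWork_comp_callWires (ω : Reg (Fin b)) (x : Reg (Fin a ⊕ Fin s)) :
    joinWork ω x ∘ callWires b a s = x := by
  funext k
  rcases k with k | k <;> rfl

theorem extend_callWires_joinWork (ω : Reg (Fin b)) (x z : Reg (Fin a ⊕ Fin s)) :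
    Function.extend (callWires b a s) z (joinWork ω x) = joinWork ω z := by
  have h : AgreeOff (callWires b a s) (joinWork ω x) (joinWork ω z) := by
    rintro ((q | j) | j) hk
    · rfl
    · exact absurd rfl (hk (Sum.inl j))
    · exact absurd rfl (hk (Sum.inr j))
  rw [← h.extend_comp_eq, joinWork_comp_callWires]

theorem branch_onQubits_callWires_mul (u : Matrix (Reg (Fin a ⊕ Fin s)) (Reg (Fin a ⊕ Fin s)) ℂ)
    (M : Matrix (Reg (Wires b a s)) (Reg (Wires b a s)) ℂ) (ω : Reg (Fin b)) :
    branch (onQubits (callWires b a s) u * M) ω = u * branch M ω := by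
  ext x y
  have h := sum_onQubits_smul (callWires b a s) u (joinWork ω x) fun z => M z (joinWork 0 y)
  simp only [joinWork_comp_callWires, extend_callWires_joinWork, smul_eq_mul] at h
  exact h

theorem branch_controlledOn_callWires_mul (q : Fin b)
    (u : Matrix (Reg (Fin a ⊕ Fin s)) (Reg (Fin a ⊕ Fin s)) ℂ)
    (M : Matrix (Reg (Wires b a s)) (Reg (Wires b a s)) ℂ) (ω : Reg (Fin b)) :
    branch (controlledOn (Sum.inl (Sum.inl q)) (onQubits (callWires b a s) u) * M) ω =
      if ω q = 1 then u * branch M ω else branch M ω := by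
  have hbranch (A : Matrix (Reg (Wires b a s)) (Reg (Wires b a s)) ℂ)
      (hA : ∀ x z, controlledOn (Sum.inl (Sum.inl q)) (onQubits (callWires b a s) u)
        (joinWork ω x) z = A (joinWork ω x) z) :
      branch (controlledOn (Sum.inl (Sum.inl q)) (onQubits (callWires b a s) u) * M) ω =
        branch (A * M) ω := by
    ext x y
    exact Finset.sum_congr rfl fun z _ => congrArg (· * _) (hA x z)
  split_ifs with hq
  · rw [← branch_onQubits_callWires_mul]
    refine hbranch _ fun x z => ?_
    rw [controlledOn, Matrix.of_apply, if_pos (show joinWork ω x (Sum.inl (Sum.inl q)) = 1 from hq),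
      onQubits_apply]
    split_ifs with h hoff hoff
    · rfl
    · rfl
    · exact absurd (hoff _ (callWires_ne_work q)) h
    · rfl
  · nth_rewrite 2 [← one_mul M]
    refine hbranch _ fun x z => ?_
    have hx : joinWork ω x (Sum.inl (Sum.inl q)) ≠ 1 := hq
    rw [controlledOn, Matrix.of_apply, if_neg hx]
    split_ifs with h
    · rfl
    · exact (Matrix.one_apply_ne fun hz => h (congrFun hz _)).symm

theorem branch_work_mul {U : Matrix (Reg (Fin a ⊕ Fin s)) (Reg (Fin a ⊕ Fin s)) ℂ}
    (g : LocalGate (Fin b)) (M : Matrix (Reg (Wires b a s)) (Reg (Wires b a s)) ℂ)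
    (ω : Reg (Fin b)) :
    branch ((Gate.work g : Gate b a).eval U * M) ω =
      ∑ z, (g.op : Matrix (Reg (Fin g.arity)) (Reg (Fin g.arity)) ℂ) (ω ∘ g.wires) z •
        branch M (Function.extend g.wires z ω) := by
  let f : Fin g.arity ↪ Wires b a s :=
    g.wires.trans (Function.Embedding.inl.trans Function.Embedding.inl)
  have hext (z : Reg (Fin g.arity)) (x : Reg (Fin a ⊕ Fin s)) :
      Function.extend f z (joinWork ω x) = joinWork (Function.extend g.wires z ω) x := by
    have h : AgreeOff f (joinWork ω x) (joinWork (Function.extend g.wires z ω) x) := by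
      rintro ((q | j) | j) hk
      · exact (agreeOff_extend g.wires z ω q fun k hq => hk k (by rw [← hq]; rfl)).symm
      · rfl
      · rfl
    rw [← h.extend_comp_eq]
    congr 1
    exact funext fun k => (g.wires.injective.extend_apply z ω k).symm
  ext x y
  rw [Matrix.sum_apply]
  have h := sum_onQubits_smul f g.op (joinWork ω x) fun z => M z (joinWork 0 y)
  simp only [hext] at h
  exact h

theorem branch_phase_mul {U : Matrix (Reg (Fin a ⊕ Fin s)) (Reg (Fin a ⊕ Fin s)) ℂ}
    (p : Fin b → Option (Fin 2)) (M : Matrix (Reg (Wires b a s)) (Reg (Wires b a s)) ℂ)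
    (ω : Reg (Fin b)) :
    branch ((Gate.phase Real.pi p true : Gate b a).eval U * M) ω =
      if ∀ q v, p q = some v → ω q = v then zeroReflection (Fin a) (Fin s) * branch M ω
      else branch M ω := by
  have hexp : Complex.exp (Complex.I * Real.pi) = -1 := by rw [mul_comm, Complex.exp_pi_mul_I]
  ext x y
  rw [branch, Matrix.of_apply, Gate.eval, Matrix.diagonal_mul]
  by_cases h : ∀ q v, p q = some v → ω q = v
  · rw [if_pos h, zeroReflection_eq_diagonal, Matrix.diagonal_mul]
    by_cases ha : ∀ j, x (Sum.inl j) = 0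
    · rw [if_pos ha, ← hexp]
      exact congrArg (· * _) (if_pos ⟨h, fun _ => ha⟩)
    · rw [if_neg ha]
      exact congrArg (· * _) (if_neg fun h' => ha (h'.2 rfl))
  · rw [if_neg h]
    exact (congrArg (· * _) (if_neg fun h' => h h'.1)).trans (one_mul _)

end Branches

/-! ### Quantum signal processing with alternating calls -/

section SignalProcessing

open Polynomial

variable {α σ : Type} {U : Matrix (Reg (α ⊕ σ)) (Reg (α ⊕ σ)) ℂ}

/-- The call that is used in step `j`: `U` in even steps and `U†` in odd steps. -/
def alternatingCall (U : Matrix (Reg (α ⊕ σ)) (Reg (α ⊕ σ)) ℂ) (j : ℕ) :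
    Matrix (Reg (α ⊕ σ)) (Reg (α ⊕ σ)) ℂ :=
  if j.bodd then U.conjTranspose else U

theorem smul_zeroBlock_alternatingCall {H : Matrix (Reg σ) (Reg σ) ℂ} (hH : H.IsHermitian) {c : ℝ}
    (hblock : (c : ℂ) • zeroBlock U = H) (j : ℕ) :
    (c : ℂ) • zeroBlock (alternatingCall U j) = H := by
  rw [alternatingCall]
  split_ifs
  · have h := congrArg Matrix.conjTranspose hblock
    rw [Matrix.conjTranspose_smul, hH] at h
    simpa [zeroBlock_conjTranspose] using h
  · exact hblock

variable [Fintype α] [DecidableEq α] [Fintype σ] [DecidableEq σ]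

theorem zeroReflection_mul_self : zeroReflection α σ * zeroReflection α σ = 1 := by
  rw [zeroReflection_eq_diagonal, Matrix.diagonal_mul_diagonal, ← Matrix.diagonal_one]
  congr 1
  funext x
  split_ifs <;> norm_num

theorem zeroReflection_mul_zeroReflection_mul (M : Matrix (Reg (α ⊕ σ)) (Reg (α ⊕ σ)) ℂ) :
    zeroReflection α σ * (zeroReflection α σ * M) = M := by
  rw [← mul_assoc, zeroReflection_mul_self, one_mul]

/-- The operator that `j` steps of quantum signal processing assign to a polynomial: `j`
alternating calls, each followed by the reflection `R`, applied after the polynomial in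
`U† R U R`. By `signalOp_succ_X_mul`, a multiplication by `X` moves the reflection of the last step
from the left to the right of its call. -/
noncomputable def signalOp (U : Matrix (Reg (α ⊕ σ)) (Reg (α ⊕ σ)) ℂ) :
    ℕ → ℂ[X] →ₗ[ℂ] Matrix (Reg (α ⊕ σ)) (Reg (α ⊕ σ)) ℂ
  | 0 => (aeval (U.conjTranspose * zeroReflection α σ * U * zeroReflection α σ)).toLinearMap
  | j + 1 => (LinearMap.mulLeft ℂ (zeroReflection α σ * alternatingCall U j)).comp (signalOp U j)

theorem alternatingCall_succ_mul_alternatingCall_mul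
    (hU : U ∈ Matrix.unitaryGroup (Reg (α ⊕ σ)) ℂ) (j : ℕ)
    (M : Matrix (Reg (α ⊕ σ)) (Reg (α ⊕ σ)) ℂ) :
    alternatingCall U (j + 1) * (alternatingCall U j * M) = M := by
  have h₁ : U * U.conjTranspose = 1 := Matrix.mem_unitaryGroup_iff.mp hU
  have h₂ : U.conjTranspose * U = 1 := Matrix.mem_unitaryGroup_iff'.mp hU
  rw [← mul_assoc, alternatingCall, alternatingCall, Nat.bodd_succ]
  cases j.bodd <;> simp [h₁, h₂]

theorem signalOp_zero_C (z : ℂ) : signalOp U 0 (C z) = z • 1 := by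
  change aeval _ (C z) = _
  rw [aeval_C, Algebra.algebraMap_eq_smul_one]

theorem signalOp_succ (j : ℕ) (f : ℂ[X]) : signalOp U (j + 1) f =
    zeroReflection α σ * (alternatingCall U j * signalOp U j f) := by
  rw [← mul_assoc]
  rfl

theorem signalOp_succ_X_mul (hU : U ∈ Matrix.unitaryGroup (Reg (α ⊕ σ)) ℂ) (j : ℕ) (f : ℂ[X]) :
    signalOp U (j + 1) (X * f) =
      alternatingCall U j * (zeroReflection α σ * signalOp U j f) := by
  induction j with
  | zero =>
    have hX : signalOp U 0 (X * f) = U.conjTranspose * zeroReflection α σ * U *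
        zeroReflection α σ * signalOp U 0 f := by
      change aeval _ (X * f) = _ * aeval _ f
      rw [map_mul, aeval_X]
    have hUU : U * U.conjTranspose = 1 := Matrix.mem_unitaryGroup_iff.mp hU
    rw [signalOp_succ, hX, show alternatingCall U 0 = U from rfl]
    simp only [mul_assoc]
    rw [← mul_assoc U U.conjTranspose, hUU, one_mul, zeroReflection_mul_zeroReflection_mul]
  | succ j ih =>
    rw [signalOp_succ, ih, alternatingCall_succ_mul_alternatingCall_mul hU,
      zeroReflection_mul_zeroReflection_mul, signalOp_succ, zeroReflection_mul_zeroReflection_mul,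
      alternatingCall_succ_mul_alternatingCall_mul hU]

theorem signalOp_add_two_X_mul (hU : U ∈ Matrix.unitaryGroup (Reg (α ⊕ σ)) ℂ) (j : ℕ)
    (f : ℂ[X]) : signalOp U (j + 2) (X * f) = signalOp U j f := by
  rw [signalOp_succ, signalOp_succ_X_mul hU, alternatingCall_succ_mul_alternatingCall_mul hU,
    zeroReflection_mul_zeroReflection_mul]

theorem signalOp_add_X_pow_mul (hU : U ∈ Matrix.unitaryGroup (Reg (α ⊕ σ)) ℂ) (j l : ℕ)
    (f : ℂ[X]) : signalOp U (j + 2 * l) (X ^ l * f) = signalOp U j f := by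
  induction l with
  | zero => simp
  | succ l ih =>
    rw [show j + 2 * (l + 1) = j + 2 * l + 2 by ring, pow_succ', mul_assoc,
      signalOp_add_two_X_mul hU, ih]

/-- The average of the positions of the reflection before and after the call cancels everything
that leaves the all-zero ancilla state. -/
theorem zeroBlock_signalOp_succ (hU : U ∈ Matrix.unitaryGroup (Reg (α ⊕ σ)) ℂ) (j : ℕ)
    (f : ℂ[X]) : zeroBlock (signalOp U (j + 1) (C (1 / 2) * (X + 1) * f)) =
      -(zeroBlock (alternatingCall U j) * zeroBlock (signalOp U j f)) := by
  have hf : C (1 / 2) * (X + 1) * f = (1 / 2 : ℂ) • (X * f + f) := by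
    rw [smul_eq_C_mul]
    ring
  rw [hf, map_smul, map_add, zeroBlock_smul, zeroBlock_add, signalOp_succ_X_mul hU, signalOp_succ,
    zeroBlock_zeroReflection_mul, ← mul_assoc, zeroBlock_mul_zeroReflection_mul]
  module

theorem smul_zeroBlock_signalOp (hU : U ∈ Matrix.unitaryGroup (Reg (α ⊕ σ)) ℂ)
    {H : Matrix (Reg σ) (Reg σ) ℂ} (hH : H.IsHermitian) {c : ℝ}
    (hblock : (c : ℂ) • zeroBlock U = H) (t : ℂ) (k : ℕ) :
    (t * c) ^ k • zeroBlock (signalOp U k ((C (1 / 2) * (X + 1)) ^ k)) = ((-t) • H) ^ k := by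
  induction k with
  | zero =>
    rw [pow_zero, pow_zero, pow_zero, ← C_1, signalOp_zero_C, one_smul, one_smul, zeroBlock_one]
  | succ k ih =>
    rw [pow_succ' (C (1 / 2) * _), zeroBlock_signalOp_succ hU, pow_succ' ((-t) • H), ← ih,
      ← smul_zeroBlock_alternatingCall hH hblock k, pow_succ', smul_neg, Matrix.smul_mul,
      Matrix.smul_mul, Matrix.mul_smul, smul_smul, smul_smul, ← neg_smul]
    congr 1
    ring

end SignalProcessing

/-! ### Two parallel signal processing sequences -/

section TwoSequences

open Polynomial Matrix

/-- The two-qubit unitary that applies `u e` to its first qubit if its second qubit is in the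
state `e`. -/
noncomputable def multiplexed (u : Fin 2 → unitaryGroup (Fin 2) ℂ) :
    unitaryGroup (Reg (Fin 2)) ℂ :=
  ⟨(blockDiagonal fun e => (u e).1).submatrix (finTwoArrowEquiv _) (finTwoArrowEquiv _), by
    have hu : (fun e => (u e).1 * (u e).1ᴴ) = 1 := funext fun e => mem_unitaryGroup_iff.mp (u e).2
    rw [mem_unitaryGroup_iff, star_eq_conjTranspose, conjTranspose_submatrix, submatrix_mul_equiv,
      blockDiagonal_conjTranspose, ← blockDiagonal_mul, hu, blockDiagonal_one,
      submatrix_one_equiv]⟩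

/-- The multiplexed unitary as a gate on two work qubits: qubit `0` carries the signal processing
sequence and qubit `1` selects one of two sequences. -/
noncomputable def multiplexedGate (u : Fin 2 → unitaryGroup (Fin 2) ℂ) : LocalGate (Fin 2) :=
  ⟨2, le_rfl, Function.Embedding.refl _, multiplexed u⟩

/-- The rotation of the selecting qubit. -/
noncomputable def selectGate (θ : ℝ) : LocalGate (Fin 2) :=
  ⟨1, one_le_two, ⟨fun _ => 1, fun _ _ _ => Subsingleton.elim _ _⟩,
    ⟨Circuit.rotation θ, Circuit.rotation_mem θ⟩⟩

theorem rotation_pi_div_four_apply_zero (x : Reg (Fin 1)) :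
    Circuit.rotation (Real.pi / 4) x 0 = ((√2 : ℝ) : ℂ)⁻¹ := by
  have h : √2 / 2 = (√2)⁻¹ := Real.sqrt_div_self
  rw [← Complex.ofReal_inv, ← h, Circuit.rotation, of_apply, Real.cos_pi_div_four,
    Real.sin_pi_div_four]
  rcases Fin.exists_fin_two.mp ⟨x 0, rfl⟩ with hx | hx <;> simp [hx]

theorem rotation_neg_pi_div_four_zero_apply (x : Reg (Fin 1)) :
    Circuit.rotation (-(Real.pi / 4)) 0 x = ((√2 : ℝ) : ℂ)⁻¹ := by
  rw [← rotation_pi_div_four_apply_zero x, Circuit.rotation, Circuit.rotation, of_apply, of_apply,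
    Real.cos_neg, Real.sin_neg]
  rcases Fin.exists_fin_two.mp ⟨x 0, rfl⟩ with hx | hx <;> simp [hx]

variable {a s : ℕ} {U : Matrix (Reg (Fin a ⊕ Fin s)) (Reg (Fin a ⊕ Fin s)) ℂ}

theorem branch_multiplexedGate_mul (u : Fin 2 → unitaryGroup (Fin 2) ℂ)
    (M : Matrix (Reg (Wires 2 a s)) (Reg (Wires 2 a s)) ℂ) (ω : Reg (Fin 2)) :
    branch ((Gate.work (multiplexedGate u)).eval U * M) ω =
      ∑ i, (u (ω 1)).1 (ω 0) i • branch M ![i, ω 1] := by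
  have hext (z : Reg (Fin 2)) : Function.extend (multiplexedGate u).wires z ω = z :=
    funext fun q => Function.injective_id.extend_apply z ω q
  rw [branch_work_mul]
  refine (Finset.sum_congr rfl fun z _ => congrArg (_ • branch M ·) (hext z)).trans ?_
  refine ((finTwoArrowEquiv (Fin 2)).symm.sum_comp _).symm.trans ?_
  rw [Fintype.sum_prod_type]
  refine Finset.sum_congr rfl fun i _ => (Finset.sum_eq_single (ω 1) (fun e _ he => ?_) ?_).trans ?_
  · exact (congrArg (· • branch M ![i, e]) (if_neg he.symm)).trans (zero_smul _ _)
  · simp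
  · exact congrArg (· • branch M ![i, ω 1]) (if_pos rfl)

theorem branch_selectGate_mul (θ : ℝ) (M : Matrix (Reg (Wires 2 a s)) (Reg (Wires 2 a s)) ℂ)
    (ω : Reg (Fin 2)) : branch ((Gate.work (selectGate θ)).eval U * M) ω =
      ∑ e, Circuit.rotation θ (fun _ => ω 1) (fun _ => e) • branch M ![ω 0, e] := by
  have hext (z : Reg (Fin 1)) : Function.extend (selectGate θ).wires z ω = ![ω 0, z 0] := by
    have h : AgreeOff (selectGate θ).wires ω ![ω 0, z 0] :=
      Fin.forall_fin_two.mpr ⟨fun _ => rfl, fun hk => absurd rfl (hk (0 : Fin 1))⟩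
    have hz : ![ω 0, z 0] ∘ (selectGate θ).wires = z :=
      funext fun k : Fin 1 => congrArg z (Subsingleton.elim 0 k)
    exact (congrArg (Function.extend _ · ω) hz.symm).trans h.extend_comp_eq
  rw [branch_work_mul]
  refine (Finset.sum_congr rfl fun z _ => congrArg (_ • branch M ·) (hext z)).trans ?_
  exact ((Equiv.funUnique (Fin 1) (Fin 2)).symm.sum_comp _).symm

/-- The branches carry two parallel signal processing sequences in equal superposition: the one
selected by qubit `1` has length `d (ω 1)`, and its polynomials are indexed by qubit `0`. -/
def IsSignalState (U : Matrix (Reg (Fin a ⊕ Fin s)) (Reg (Fin a ⊕ Fin s)) ℂ) (d : Fin 2 → ℕ)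
    (f : Fin 2 → Fin 2 → ℂ[X]) (M : Matrix (Reg (Wires 2 a s)) (Reg (Wires 2 a s)) ℂ) : Prop :=
  ∀ ω : Reg (Fin 2), branch M ω = ((√2 : ℝ) : ℂ)⁻¹ • signalOp U (d (ω 1)) (f (ω 1) (ω 0))

theorem branch_selectGate_pi_div_four (ω : Reg (Fin 2)) :
    branch ((Gate.work (selectGate (Real.pi / 4))).eval U) ω =
      if ω 0 = 0 then ((√2 : ℝ) : ℂ)⁻¹ • 1 else 0 := by
  have hone : (![ω 0, 1] : Reg (Fin 2)) ≠ 0 := fun h => one_ne_zero (congrFun h 1)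
  have hzero : (![ω 0, 0] : Reg (Fin 2)) = 0 ↔ ω 0 = 0 := by
    simp [funext_iff, Fin.forall_fin_two]
  rw [← mul_one (Gate.eval U _), branch_selectGate_mul, Fin.sum_univ_two, branch_one, branch_one,
    if_neg hone, smul_zero, add_zero, smul_ite, smul_zero]
  simp only [hzero]
  exact congrArg (if ω 0 = 0 then · • _ else _) (rotation_pi_div_four_apply_zero _)

theorem isSignalState_initial {u : Fin 2 → unitaryGroup (Fin 2) ℂ} {f : Fin 2 → Fin 2 → ℂ[X]}
    (hf : ∀ e i, f e i = C ((u e).1 i 0)) :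
    IsSignalState U (fun _ => 0) f (Circuit.eval U
      [Gate.work (selectGate (Real.pi / 4)), Gate.work (multiplexedGate u)]) := by
  intro ω
  rw [Circuit.eval, Circuit.eval_singleton, branch_multiplexedGate_mul, Fin.sum_univ_two,
    branch_selectGate_pi_div_four, branch_selectGate_pi_div_four, hf, signalOp_zero_C]
  simp only [cons_val_zero, if_true, one_ne_zero, if_false, smul_zero, add_zero]
  exact smul_comm _ _ _

/-- One step of both sequences, or of the second one only if the call is controlled on the
selecting qubit. -/
noncomputable def signalStep (ctrl : Option (Fin 2)) (inv : Bool)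
    (u : Fin 2 → unitaryGroup (Fin 2) ℂ) : Circuit 2 a :=
  [Gate.phase Real.pi ![some 0, ctrl.map fun _ => 1] true, Gate.call ctrl inv,
    Gate.phase Real.pi ![some 1, ctrl.map fun _ => 1] true, Gate.work (multiplexedGate u)]

theorem eval_signalStep_mul (ctrl : Option (Fin 2)) (inv : Bool)
    (u : Fin 2 → unitaryGroup (Fin 2) ℂ) (M : Matrix (Reg (Wires 2 a s)) (Reg (Wires 2 a s)) ℂ) :
    Circuit.eval U (signalStep ctrl inv u) * M =
      (Gate.work (multiplexedGate u)).eval U *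
        ((Gate.phase Real.pi ![some 1, ctrl.map fun _ => 1] true).eval U *
          ((Gate.call ctrl inv).eval U *
            ((Gate.phase Real.pi ![some 0, ctrl.map fun _ => 1] true).eval U * M))) := by
  simp only [signalStep, Circuit.eval, one_mul, mul_assoc]

variable {d : ℕ} {f g : Fin 2 → Fin 2 → ℂ[X]} {u : Fin 2 → unitaryGroup (Fin 2) ℂ}
  {M : Matrix (Reg (Wires 2 a s)) (Reg (Wires 2 a s)) ℂ}

theorem branch_signalStep_none (hU : U ∈ unitaryGroup (Reg (Fin a ⊕ Fin s)) ℂ)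
    (hM : IsSignalState U (fun _ => d) g M) (ω : Reg (Fin 2)) :
    branch ((Gate.phase Real.pi ![some 1, none] true).eval U *
      ((Gate.call none d.bodd).eval U *
        ((Gate.phase Real.pi ![some 0, none] true).eval U * M))) ω =
    ((√2 : ℝ) : ℂ)⁻¹ • signalOp U (d + 1) (![X * g (ω 1) 0, g (ω 1) 1] (ω 0)) := by
  have hcond (c : Fin 2) : (∀ q v, (![some c, none] : Fin 2 → Option (Fin 2)) q = some v →
      ω q = v) ↔ ω 0 = c := by
    fin_cases c <;> simp [Fin.forall_fin_two (p := fun _ => ∀ _, _), eq_comm]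
  rw [branch_phase_mul, show (Gate.call none d.bodd : Gate 2 a).eval U =
    onQubits (callWires 2 a s) (alternatingCall U d) from rfl, branch_onQubits_callWires_mul,
    branch_phase_mul, hM]
  simp only [hcond]
  rcases Fin.exists_fin_two.mp ⟨ω 0, rfl⟩ with h0 | h0
  · rw [h0, if_neg zero_ne_one, if_pos rfl, cons_val_zero, signalOp_succ_X_mul hU,
      Matrix.mul_smul, Matrix.mul_smul]
  · rw [h0, if_pos rfl, if_neg one_ne_zero, cons_val_one, cons_val_zero, signalOp_succ,
      Matrix.mul_smul, Matrix.mul_smul]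

theorem branch_signalStep_some (hU : U ∈ unitaryGroup (Reg (Fin a ⊕ Fin s)) ℂ)
    (hM : IsSignalState U (fun _ => d) g M) (ω : Reg (Fin 2)) :
    branch ((Gate.phase Real.pi ![some 1, some 1] true).eval U *
      ((Gate.call (some 1) d.bodd).eval U *
        ((Gate.phase Real.pi ![some 0, some 1] true).eval U * M))) ω =
    ((√2 : ℝ) : ℂ)⁻¹ • if ω 1 = 1 then signalOp U (d + 1) (![X * g 1 0, g 1 1] (ω 0))
      else signalOp U d (g 0 (ω 0)) := by
  have hcond (c : Fin 2) : (∀ q v, (![some c, some 1] : Fin 2 → Option (Fin 2)) q = some v →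
      ω q = v) ↔ ω 0 = c ∧ ω 1 = 1 := by
    fin_cases c <;> simp [Fin.forall_fin_two (p := fun _ => ∀ _, _), eq_comm]
  rw [branch_phase_mul, show (Gate.call (some 1) d.bodd : Gate 2 a).eval U =
    controlledOn (Sum.inl (Sum.inl 1)) (onQubits (callWires 2 a s) (alternatingCall U d)) from rfl,
    branch_controlledOn_callWires_mul, branch_phase_mul, hM]
  simp only [hcond]
  rcases Fin.exists_fin_two.mp ⟨ω 1, rfl⟩ with h1 | h1
  · simp only [h1, zero_ne_one, and_false, if_false]
  rcases Fin.exists_fin_two.mp ⟨ω 0, rfl⟩ with h0 | h0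
  · simp only [h0, h1, zero_ne_one, and_true, if_true, if_false, cons_val_zero,
      signalOp_succ_X_mul hU, Matrix.mul_smul]
  · simp only [h0, h1, one_ne_zero, and_true, if_true, if_false, cons_val_one, cons_val_zero,
      signalOp_succ, Matrix.mul_smul]

theorem sum_smul_signalOp (j : ℕ) (A : Matrix (Fin 2) (Fin 2) ℂ) (h : Fin 2 → ℂ[X]) (k : Fin 2) :
    ∑ i, A k i • signalOp U j (h i) = signalOp U j ((A.map C *ᵥ h) k) := by
  simp [Matrix.mulVec, dotProduct, ← smul_eq_C_mul]

theorem IsSignalState.step (hM : IsSignalState U (fun _ => d) g M)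
    (hU : U ∈ unitaryGroup (Reg (Fin a ⊕ Fin s)) ℂ)
    (hf : ∀ e, f e = (u e).1.map C *ᵥ ![X * g e 0, g e 1]) :
    IsSignalState U (fun _ => d + 1) f (Circuit.eval U (signalStep none d.bodd u) * M) := by
  intro ω
  rw [eval_signalStep_mul, branch_multiplexedGate_mul, hf, ← sum_smul_signalOp, Finset.smul_sum]
  refine Finset.sum_congr rfl fun i _ => ?_
  rw [Option.map_none, branch_signalStep_none hU hM, smul_comm]
  rfl

theorem IsSignalState.step_second (hM : IsSignalState U (fun _ => d) g M)
    (hU : U ∈ unitaryGroup (Reg (Fin a ⊕ Fin s)) ℂ) (v : unitaryGroup (Fin 2) ℂ) :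
    IsSignalState U ![d, d + 1] ![g 0, v.1.map C *ᵥ ![X * g 1 0, g 1 1]]
      (Circuit.eval U (signalStep (some 1) d.bodd ![1, v]) * M) := by
  intro ω
  rw [eval_signalStep_mul, branch_multiplexedGate_mul, Option.map_some]
  simp only [branch_signalStep_some hU hM, smul_comm _ (((√2 : ℝ) : ℂ)⁻¹), ← Finset.smul_sum]
  congr 1
  rcases Fin.exists_fin_two.mp ⟨ω 1, rfl⟩ with h1 | h1
  · simp [h1, Matrix.one_apply]
  · simp only [h1]
    exact sum_smul_signalOp _ _ _ _

theorem exists_circuit_of_isUnitPolyVector (a d : ℕ) (f : Fin 2 → Fin 2 → ℂ[X])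
    (hf : ∀ e, IsUnitPolyVector d (f e)) :
    ∃ c : Circuit 2 a, c.calls = d ∧ c.otherGates = 3 * d + 2 ∧
      ∀ (s : ℕ) (U : Matrix (Reg (Fin a ⊕ Fin s)) (Reg (Fin a ⊕ Fin s)) ℂ),
        U ∈ unitaryGroup (Reg (Fin a ⊕ Fin s)) ℂ →
        IsSignalState U (fun _ => d) f (Circuit.eval U c) := by
  induction d generalizing f with
  | zero =>
    choose u hu using fun e => (hf e).exists_eq_C
    exact ⟨[Gate.work (selectGate (Real.pi / 4)), Gate.work (multiplexedGate u)], rfl, rfl,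
      fun s U _ => isSignalState_initial hu⟩
  | succ d ih =>
    choose u g hg hfg using fun e => (hf e).exists_eq_mulVec
    obtain ⟨c, hcalls, hgates, hc⟩ := ih g hg
    refine ⟨c ++ signalStep none d.bodd u, ?_, ?_, fun s U hU => ?_⟩
    · rw [Circuit.calls_append, hcalls]
      rfl
    · rw [Circuit.otherGates_append, hgates]
      rfl
    · rw [Circuit.eval_append]
      exact (hc s U hU).step hU hfg

theorem IsSignalState.zeroBlock_selectGate_mul {d : Fin 2 → ℕ} (hM : IsSignalState U d f M) :
    zeroBlock ((Gate.work (selectGate (-(Real.pi / 4)))).eval U * M) = (1 / 2 : ℂ) •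
      (zeroBlock (signalOp U (d 0) (f 0 0)) + zeroBlock (signalOp U (d 1) (f 1 0))) := by
  have hsqrt : ((√2 : ℝ) : ℂ)⁻¹ * ((√2 : ℝ) : ℂ)⁻¹ = 1 / 2 := by
    rw [← mul_inv, ← Complex.ofReal_mul, Real.mul_self_sqrt zero_le_two, Complex.ofReal_ofNat,
      one_div]
  rw [← zeroBlock_branch_zero, branch_selectGate_mul, Fin.sum_univ_two, hM, hM, zeroBlock_add,
    zeroBlock_smul, zeroBlock_smul, zeroBlock_smul, zeroBlock_smul, smul_add, ← hsqrt, mul_smul,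
    mul_smul]
  exact congrArg₂ (fun x y : ℂ => x • _ + y • _) (rotation_neg_pi_div_four_zero_apply _)
    (rotation_neg_pi_div_four_zero_apply _)

theorem exists_circuit_of_norm_lt_one (a d : ℕ) {P Q : ℂ[X]} (hPd : P.natDegree ≤ d)
    (hQd : Q.natDegree ≤ d + 1) (hP : ∀ w : ℂ, ‖w‖ = 1 → ‖P.eval w‖ < 1)
    (hQ : ∀ w : ℂ, ‖w‖ = 1 → ‖Q.eval w‖ < 1) :
    ∃ c : Circuit 2 a, c.calls = d + 1 ∧ c.otherGates = 3 * d + 6 ∧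
      ∀ (s : ℕ) (U : Matrix (Reg (Fin a ⊕ Fin s)) (Reg (Fin a ⊕ Fin s)) ℂ),
        U ∈ unitaryGroup (Reg (Fin a ⊕ Fin s)) ℂ →
        zeroBlock (Circuit.eval U c) = (1 / 2 : ℂ) •
          (zeroBlock (signalOp U d P) + zeroBlock (signalOp U (d + 1) Q)) := by
  obtain ⟨P', hPP'⟩ := exists_isUnitPolyVector_of_norm_lt_one hPd hP
  obtain ⟨Q', hQQ'⟩ := exists_isUnitPolyVector_of_norm_lt_one hQd hQ
  obtain ⟨v, g, hg, hQg⟩ := hQQ'.exists_eq_mulVec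
  obtain ⟨c, hcalls, hgates, hc⟩ := exists_circuit_of_isUnitPolyVector a d ![![P, P'], g]
    (Fin.forall_fin_two.mpr ⟨hPP', hg⟩)
  refine ⟨c ++ signalStep (some 1) d.bodd ![1, v] ++
    [Gate.work (selectGate (-(Real.pi / 4)))], ?_, ?_, fun s U hU => ?_⟩
  · rw [Circuit.calls_append, Circuit.calls_append, hcalls]
    rfl
  · rw [Circuit.otherGates_append, Circuit.otherGates_append, hgates]
    rfl
  · have hstate := (hc s U hU).step_second hU v
    rw [Circuit.eval_append, Circuit.eval_singleton, Circuit.eval_append,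
      hstate.zeroBlock_selectGate_mul]
    have hQ0 : Q = (v.1.map C *ᵥ ![X * g 0, g 1]) 0 := congrFun hQg 0
    rw [hQ0]
    rfl

end TwoSequences

/-! ### The truncated exponential series -/

section Taylor

open Polynomial

theorem pow_add_div_factorial_le {τ r : ℝ} (hτ : 0 ≤ τ) {n : ℕ} (hr : τ ≤ r * (n + 1)) (i : ℕ) :
    τ ^ (i + n) / (i + n).factorial ≤ τ ^ n / n.factorial * r ^ i := by
  have hfactorial : (n.factorial * (n + 1) ^ i : ℝ) ≤ ((i + n).factorial : ℝ) := by
    rw [add_comm i n]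
    exact_mod_cast Nat.factorial_mul_pow_le_factorial
  calc τ ^ (i + n) / (i + n).factorial
      ≤ τ ^ (i + n) / (n.factorial * (n + 1) ^ i) := by gcongr
    _ = τ ^ n / n.factorial * (τ / (n + 1)) ^ i := by
        rw [pow_add, div_pow, div_mul_div_comm, mul_comm (τ ^ i)]
    _ ≤ τ ^ n / n.factorial * r ^ i := by
        gcongr
        exact (div_le_iff₀ (by positivity)).mpr hr

theorem norm_exp_sub_sum_le {𝔸 : Type*} [NormedRing 𝔸] [NormedAlgebra ℂ 𝔸] [CompleteSpace 𝔸]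
    {x : 𝔸} {τ r : ℝ} (hx : ‖x‖ ≤ τ) {n : ℕ} (hn : 0 < n) (hr : τ ≤ r * (n + 1)) (hr1 : r < 1) :
    ‖NormedSpace.exp x - ∑ k ∈ Finset.range n, ((k.factorial : ℂ)⁻¹) • x ^ k‖ ≤
      τ ^ n / n.factorial * (1 - r)⁻¹ := by
  have hτ : 0 ≤ τ := (norm_nonneg _).trans hx
  have hr0 : 0 ≤ r := nonneg_of_mul_nonneg_left (hτ.trans hr) (by positivity)
  have htail := (hasSum_nat_add_iff' n).mpr (NormedSpace.exp_series_hasSum_exp' (𝕂 := ℂ) x)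
  rw [← htail.tsum_eq]
  refine tsum_of_norm_bounded ((hasSum_geometric_of_lt_one hr0 hr1).mul_left _) fun i => ?_
  have hpow : ‖x ^ (i + n)‖ ≤ τ ^ (i + n) :=
    (norm_pow_le' x (by omega)).trans (pow_le_pow_left₀ (norm_nonneg _) hx _)
  rw [norm_smul, norm_inv, Complex.norm_natCast, inv_mul_eq_div]
  exact (div_le_div_of_nonneg_right hpow (by positivity)).trans (pow_add_div_factorial_le hτ hr i)

theorem add_one_pow_le_exp_one_mul (n : ℕ) : ((n : ℝ) + 1) ^ n ≤ Real.exp 1 * (n : ℝ) ^ n := by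
  rcases n.eq_zero_or_pos with rfl | hn
  · simp
  have hn0 : (n : ℝ) ≠ 0 := Nat.cast_ne_zero.mpr hn.ne'
  calc ((n : ℝ) + 1) ^ n = (1 + (n : ℝ)⁻¹) ^ n * (n : ℝ) ^ n := by
        rw [← mul_pow, add_mul, inv_mul_cancel₀ hn0, one_mul]
    _ ≤ Real.exp 1 * (n : ℝ) ^ n := by
        gcongr
        exact Real.one_add_inv_pow_le_exp

/-- The ratio of consecutive left-hand sides is at most `exp 1 / 5.6`. -/
theorem div_pow_div_factorial_le {n : ℕ} (hn : 2 ≤ n) :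
    ((n : ℝ) / 5.6) ^ n / n.factorial ≤ 1 / 10 := by
  induction n, hn using Nat.le_induction with
  | base => norm_num [Nat.factorial]
  | succ n hn ih =>
    refine le_trans ?_ ih
    have hpow : ((n : ℝ) + 1) ^ n ≤ 5.6 * (n : ℝ) ^ n :=
      (add_one_pow_le_exp_one_mul n).trans (by gcongr; linarith [Real.exp_one_lt_d9])
    calc (((n + 1 : ℕ) : ℝ) / 5.6) ^ (n + 1) / (n + 1).factorial
        = ((n : ℝ) + 1) ^ n / 5.6 / (5.6 ^ n * n.factorial) := by
          rw [Nat.factorial_succ]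
          push_cast
          rw [div_pow, pow_succ, pow_succ]
          field_simp
      _ ≤ (n : ℝ) ^ n / (5.6 ^ n * n.factorial) := by
          gcongr
          exact (div_le_iff₀' (by norm_num)).mpr hpow
      _ = ((n : ℝ) / 5.6) ^ n / n.factorial := by rw [div_pow, div_div]

theorem pow_div_factorial_le_of_log_le {τ ε : ℝ} (hτ : 0 ≤ τ) (hε : 0 < ε) {R : ℕ} (hR : 0 < R)
    (h : 2.8 * τ + Real.log (1 / ε) ≤ R) :
    τ ^ (2 * R) / (2 * R).factorial ≤ ε ^ 2 / 10 := by
  have hR0 : (0 : ℝ) < R := Nat.cast_pos.mpr hR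
  set x := ((2 * R : ℕ) : ℝ) / 5.6
  have hτx : τ ≤ x * Real.exp (Real.log ε / R) := by
    have hexp := mul_le_mul_of_nonneg_right (Real.add_one_le_exp (Real.log ε / R)) hR0.le
    rw [add_mul, div_mul_cancel₀ _ hR0.ne', one_mul] at hexp
    rw [one_div, Real.log_inv] at h
    have hx : x = R / 2.8 := by
      simp only [x]
      push_cast
      ring
    rw [hx, div_mul_eq_mul_div, le_div_iff₀ (by norm_num)]
    linarith
  have hpow : Real.exp (Real.log ε / R) ^ (2 * R) = ε ^ 2 := by
    rw [mul_comm 2 R, pow_mul, ← Real.exp_nat_mul, mul_div_cancel₀ _ hR0.ne', Real.exp_log hε]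
  calc τ ^ (2 * R) / (2 * R).factorial
      ≤ (x * Real.exp (Real.log ε / R)) ^ (2 * R) / (2 * R).factorial := by gcongr
    _ = x ^ (2 * R) / (2 * R).factorial * ε ^ 2 := by rw [mul_pow, hpow, div_mul_eq_mul_div]
    _ ≤ 1 / 10 * ε ^ 2 :=
        mul_le_mul_of_nonneg_right (div_pow_div_factorial_le (by omega)) (sq_nonneg ε)
    _ = ε ^ 2 / 10 := one_div_mul_eq_div _ _

theorem sum_range_even_add_odd {E : Type*} [AddCommMonoid E] (f : ℕ → E) (n : ℕ) :
    ∑ j ∈ Finset.range n, f (2 * j) + ∑ j ∈ Finset.range n, f (2 * j + 1) =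
      ∑ k ∈ Finset.range (2 * n), f k := by
  induction n with
  | zero => simp
  | succ n ih =>
    rw [mul_add_one, Finset.sum_range_succ _ (2 * n + 1), Finset.sum_range_succ _ (2 * n), ← ih,
      Finset.sum_range_succ, Finset.sum_range_succ]
    abel

theorem norm_sum_of_parity_le {c : ℕ → ℂ} {v : ℂ} {n : ℕ} {B : ℝ}
    (hpos : ‖∑ k ∈ Finset.range (2 * n), c k * v ^ k‖ ≤ B)
    (hneg : ‖∑ k ∈ Finset.range (2 * n), c k * (-v) ^ k‖ ≤ B) {e : ℕ} (he : e < 2) :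
    ‖∑ j ∈ Finset.range n, c (2 * j + e) * v ^ (2 * j + e)‖ ≤ B := by
  rw [← sum_range_even_add_odd] at hpos hneg
  simp only [(even_two_mul _).neg_pow, (odd_two_mul_add_one _).neg_pow, mul_neg,
    Finset.sum_neg_distrib] at hneg
  set p := ∑ j ∈ Finset.range n, c (2 * j) * v ^ (2 * j)
  set q := ∑ j ∈ Finset.range n, c (2 * j + 1) * v ^ (2 * j + 1)
  have hp : 2 * ‖p‖ = ‖p + q + (p + -q)‖ := by rw [← Complex.norm_two, ← norm_mul]; congr 1; ring
  have hq : 2 * ‖q‖ = ‖p + q - (p + -q)‖ := by rw [← Complex.norm_two, ← norm_mul]; congr 1; ring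
  interval_cases e
  · change ‖p‖ ≤ B
    linarith [norm_add_le (p + q) (p + -q)]
  · linarith [norm_sub_le (p + q) (p + -q)]

theorem norm_sum_range_I_mul_pow_le {τ x : ℝ} (hx : |x| ≤ τ) {n : ℕ} (hn : 0 < n)
    (hτ : τ ≤ 1 / 5 * (n + 1)) (herr : τ ^ n / n.factorial ≤ 1 / 10) :
    ‖∑ k ∈ Finset.range n, (k.factorial : ℂ)⁻¹ * (Complex.I * x) ^ k‖ ≤ 9 / 8 := by
  have hnorm : ‖Complex.I * (x : ℂ)‖ ≤ τ := by
    rwa [norm_mul, Complex.norm_I, one_mul, Complex.norm_real, Real.norm_eq_abs]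
  have hexp : ‖NormedSpace.exp (Complex.I * (x : ℂ))‖ = 1 := by
    rw [← Complex.exp_eq_exp_ℂ, mul_comm, Complex.norm_exp_ofReal_mul_I]
  have htail := norm_exp_sub_sum_le hnorm hn hτ (by norm_num)
  simp only [smul_eq_mul] at htail
  have htriangle := norm_le_norm_add_norm_sub' (∑ k ∈ Finset.range n,
    (k.factorial : ℂ)⁻¹ * (Complex.I * x) ^ k) (NormedSpace.exp (Complex.I * (x : ℂ)))
  rw [norm_sub_rev] at htriangle
  linarith

/-- The polynomial whose signal processing sequence encodes the even (`e = 0`) or odd (`e = 1`)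
part of the exponential series of `y`, truncated after the term of degree `2 * l + e`. -/
noncomputable def seriesPoly (y : ℂ) (l e : ℕ) : ℂ[X] :=
  ∑ j ∈ Finset.range (l + 1), C (((2 * j + e).factorial : ℂ)⁻¹ * y ^ (2 * j + e)) *
    (X ^ (l - j) * (C (1 / 2) * (X + 1)) ^ (2 * j + e))

theorem natDegree_seriesPoly_le (y : ℂ) (l e : ℕ) : (seriesPoly y l e).natDegree ≤ 2 * l + e := by
  refine natDegree_sum_le_of_forall_le _ _ fun j hj => ?_
  have hlin : (C (1 / 2 : ℂ) * (X + 1)).natDegree ≤ 1 :=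
    (natDegree_C_mul_le _ _).trans (natDegree_X_add_C (1 : ℂ)).le
  have hpow : ((C (1 / 2 : ℂ) * (X + 1)) ^ (2 * j + e)).natDegree ≤ (2 * j + e) * 1 :=
    natDegree_pow_le_of_le _ hlin
  refine (natDegree_C_mul_le _ _).trans (natDegree_mul_le.trans ?_)
  rw [natDegree_X_pow]
  have := Finset.mem_range.mp hj
  omega

/-- On the unit circle, `(w + 1) / 2 = z * re z` if `w = z ^ 2`. -/
theorem eval_sq_seriesPoly (y : ℂ) (l e : ℕ) {z : ℂ} (hz : ‖z‖ = 1) :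
    (seriesPoly y l e).eval (z ^ 2) = z ^ (2 * l + e) * ∑ j ∈ Finset.range (l + 1),
      ((2 * j + e).factorial : ℂ)⁻¹ * (y * z.re) ^ (2 * j + e) := by
  have hconj : z * starRingEnd ℂ z = 1 := by rw [Complex.mul_conj', hz, Complex.ofReal_one, one_pow]
  have hre : 1 / 2 * (z ^ 2 + 1) = z * z.re := by
    rw [Complex.re_eq_add_conj]
    linear_combination (-1 / 2 : ℂ) * hconj
  rw [seriesPoly, eval_finsetSum, Finset.mul_sum]
  refine Finset.sum_congr rfl fun j hj => ?_
  have hdeg : 2 * l + e = 2 * (l - j) + (2 * j + e) := by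
    have := Finset.mem_range.mp hj
    omega
  simp only [eval_mul, eval_C, eval_pow, eval_X, eval_add, eval_one, hre]
  rw [hdeg, pow_add z, pow_mul z]
  ring

theorem norm_eval_seriesPoly_le {τ : ℝ} (hτ : 0 ≤ τ) {l e : ℕ} (he : e < 2)
    (hl : τ ≤ 1 / 5 * ((2 * (l + 1) : ℕ) + 1))
    (herr : τ ^ (2 * (l + 1)) / (2 * (l + 1)).factorial ≤ 1 / 10) {w : ℂ} (hw : ‖w‖ = 1) :
    ‖(seriesPoly (Complex.I * τ) l e).eval w‖ ≤ 9 / 8 := by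
  obtain ⟨z, rfl⟩ := IsAlgClosed.exists_pow_nat_eq w (n := 2) (by norm_num)
  have hz : ‖z‖ = 1 := by
    rwa [norm_pow, pow_eq_one_iff_of_nonneg (norm_nonneg z) two_ne_zero] at hw
  have hre : |τ * z.re| ≤ τ := by
    rw [abs_mul, abs_of_nonneg hτ]
    exact mul_le_of_le_one_right hτ (hz ▸ Complex.abs_re_le_norm z)
  have hpos := norm_sum_range_I_mul_pow_le hre (by omega) hl herr
  have hneg := norm_sum_range_I_mul_pow_le ((abs_neg _).trans_le hre) (by omega) hl herr
  rw [Complex.ofReal_neg, mul_neg] at hneg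
  rw [eval_sq_seriesPoly _ _ _ hz, norm_mul, norm_pow, hz, one_pow, one_mul, mul_assoc,
    ← Complex.ofReal_mul]
  exact norm_sum_of_parity_le hpos hneg he

theorem zeroBlock_signalOp_seriesPoly {α σ : Type} [Fintype α] [DecidableEq α] [Fintype σ]
    [DecidableEq σ] {U : Matrix (Reg (α ⊕ σ)) (Reg (α ⊕ σ)) ℂ}
    (hU : U ∈ Matrix.unitaryGroup (Reg (α ⊕ σ)) ℂ)
    {H : Matrix (Reg σ) (Reg σ) ℂ} (hH : H.IsHermitian) {c : ℝ}
    (hblock : (c : ℂ) • zeroBlock U = H) (t : ℂ) (l e : ℕ) :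
    zeroBlock (signalOp U (2 * l + e) (seriesPoly (t * c) l e)) =
      ∑ j ∈ Finset.range (l + 1), ((2 * j + e).factorial : ℂ)⁻¹ • ((-t) • H) ^ (2 * j + e) := by
  rw [seriesPoly, map_sum, zeroBlock_sum]
  refine Finset.sum_congr rfl fun j hj => ?_
  have hdeg : 2 * l + e = 2 * j + e + 2 * (l - j) := by
    have := Finset.mem_range.mp hj
    omega
  rw [← smul_eq_C_mul, map_smul, zeroBlock_smul, hdeg, signalOp_add_X_pow_mul hU, mul_smul,
    smul_zeroBlock_signalOp hU hH hblock]

end Taylor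

/-! ### Hamiltonian simulation -/

section Simulation

open Polynomial

theorem IsBlockEncoding.smul_zeroBlock_eq {α σ : Type} [Fintype α] [DecidableEq α] [Fintype σ]
    [DecidableEq σ] {c : ℝ} {U : Matrix (Reg (α ⊕ σ)) (Reg (α ⊕ σ)) ℂ}
    {A : Matrix (Reg σ) (Reg σ) ℂ} (hU : IsBlockEncoding c 0 U A) :
    (c : ℂ) • zeroBlock U = A :=
  (sub_eq_zero.mp (EmbeddingLike.map_eq_zero_iff.mp (norm_le_zero_iff.mp hU.error_le))).symm

theorem IsBlockEncoding.specNorm_le {α σ : Type} [Fintype α] [DecidableEq α] [Fintype σ]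
    [DecidableEq σ] {c δ : ℝ} {U : Matrix (Reg (α ⊕ σ)) (Reg (α ⊕ σ)) ℂ}
    {A : Matrix (Reg σ) (Reg σ) ℂ} (hU : IsBlockEncoding c δ U A) : specNorm A ≤ c + δ := by
  have hblock : specNorm ((c : ℂ) • zeroBlock U) ≤ c := by
    rw [specNorm, map_smul, norm_smul, Complex.norm_real, Real.norm_of_nonneg hU.nonneg]
    exact mul_le_of_le_one_right hU.nonneg (specNorm_zeroBlock_le_one hU.unitary)
  have htriangle : specNorm A ≤
      specNorm ((c : ℂ) • zeroBlock U) + specNorm (A - (c : ℂ) • zeroBlock U) := by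
    simp only [specNorm, map_sub]
    exact norm_le_norm_add_norm_sub' _ _
  linarith [hU.error_le]

open scoped Matrix.Norms.L2Operator in
theorem exp_neg_I_smul_mem_unitaryGroup {ι : Type} [Fintype ι] [DecidableEq ι]
    {H : Matrix ι ι ℂ} (hH : H.IsHermitian) (t : ℝ) :
    NormedSpace.exp ((-(Complex.I * t)) • H) ∈ Matrix.unitaryGroup ι ℂ := by
  let := NormedAlgebra.restrictScalars ℚ ℂ (Matrix ι ι ℂ)
  exact NormedSpace.exp_mem_unitary_of_mem_skewAdjoint
    (IsSelfAdjoint.smul_mem_skewAdjoint (by simp [skewAdjoint.mem_iff]) hH)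

open scoped Matrix.Norms.L2Operator in
theorem specNorm_exp_sub_sum_le {ι : Type} [Fintype ι] [DecidableEq ι]
    {A : Matrix (Reg ι) (Reg ι) ℂ} {τ r : ℝ} (hA : specNorm A ≤ τ) {n : ℕ} (hn : 0 < n)
    (hr : τ ≤ r * (n + 1)) (hr1 : r < 1) :
    specNorm (NormedSpace.exp A - ∑ k ∈ Finset.range n, ((k.factorial : ℂ)⁻¹) • A ^ k) ≤
      τ ^ n / n.factorial * (1 - r)⁻¹ := by
  exact norm_exp_sub_sum_le (show ‖A‖ ≤ τ from hA) hn hr hr1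

variable {a s : ℕ} {U : Matrix (Reg (Fin a ⊕ Fin s)) (Reg (Fin a ⊕ Fin s)) ℂ}

theorem IsBlockEncoding.damp (hU : U ∈ Matrix.unitaryGroup (Reg (Fin a ⊕ Fin s)) ℂ) {b : ℕ}
    {V : Circuit b a} {A : Matrix (Reg (Fin s)) (Reg (Fin s)) ℂ} {α β δ : ℝ}
    (hV : IsBlockEncoding α δ (V.eval U) A) (h : α ≤ β) :
    IsBlockEncoding β δ ((V.damp (Real.arccos (α / β))).eval U) A := by
  have hβ : 0 ≤ β := hV.nonneg.trans h
  have hcos : Real.cos (Real.arccos (α / β)) = α / β :=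
    Real.cos_arccos (by linarith [div_nonneg hV.nonneg hβ]) (div_le_one_of_le₀ h hβ)
  have hmul : β * (α / β) = α := mul_div_cancel_of_imp' fun h0 => le_antisymm (h0 ▸ h) hV.nonneg
  refine ⟨Circuit.eval_mem_unitaryGroup hU _, hβ, ?_⟩
  rw [Circuit.zeroBlock_eval_damp, hcos, smul_smul, ← Complex.ofReal_mul, hmul]
  exact hV.error_le

theorem exists_circuit_smul_zeroBlock_eq_sum (hU : U ∈ Matrix.unitaryGroup (Reg (Fin a ⊕ Fin s)) ℂ)
    {H : Matrix (Reg (Fin s)) (Reg (Fin s)) ℂ} (hH : H.IsHermitian) {c : ℝ}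
    (hblock : (c : ℂ) • zeroBlock U = H) {t : ℝ} (hct : 0 ≤ c * t) {l : ℕ}
    (hl : c * t ≤ 1 / 5 * ((2 * (l + 1) : ℕ) + 1))
    (herr : (c * t) ^ (2 * (l + 1)) / (2 * (l + 1)).factorial ≤ 1 / 10) :
    ∃ V : Circuit 2 a, V.calls = 2 * l + 1 ∧ V.otherGates = 6 * l + 6 ∧
      ((5 / 2 : ℝ) : ℂ) • zeroBlock (V.eval U) = ∑ k ∈ Finset.range (2 * (l + 1)),
        ((k.factorial : ℂ)⁻¹) • ((-(Complex.I * t)) • H) ^ k := by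
  have hdeg (e : ℕ) : (C (4 / 5) * seriesPoly (Complex.I * (c * t : ℝ)) l e).natDegree ≤
      2 * l + e :=
    (natDegree_C_mul_le _ _).trans (natDegree_seriesPoly_le _ l e)
  have hnorm {e : ℕ} (he : e < 2) (w : ℂ) (hw : ‖w‖ = 1) :
      ‖(C (4 / 5) * seriesPoly (Complex.I * (c * t : ℝ)) l e).eval w‖ < 1 := by
    have h := norm_eval_seriesPoly_le hct he hl herr hw
    have hscale : ‖(4 / 5 : ℂ)‖ = 4 / 5 := by norm_num
    rw [eval_mul, eval_C, norm_mul, hscale]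
    linarith
  have hblocks (e : ℕ) : zeroBlock (signalOp U (2 * l + e)
      (C (4 / 5) * seriesPoly (Complex.I * (c * t : ℝ)) l e)) =
      (4 / 5 : ℂ) • ∑ j ∈ Finset.range (l + 1),
        ((2 * j + e).factorial : ℂ)⁻¹ • ((-(Complex.I * t)) • H) ^ (2 * j + e) := by
    rw [← zeroBlock_signalOp_seriesPoly hU hH hblock, ← smul_eq_C_mul, map_smul, zeroBlock_smul,
      Complex.ofReal_mul, mul_comm (c : ℂ), mul_assoc]
  obtain ⟨V, hcalls, hgates, hV⟩ := exists_circuit_of_norm_lt_one a (2 * l) (hdeg 0) (hdeg 1)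
    (hnorm zero_lt_two) (hnorm one_lt_two)
  refine ⟨V, hcalls, by rw [hgates]; ring, ?_⟩
  have hscale : ((5 / 2 : ℝ) : ℂ) * (1 / 2 * (4 / 5)) = 1 := by norm_num
  rw [hV s U hU, ← sum_range_even_add_odd, hblocks 1, ← add_zero (2 * l), hblocks 0, ← smul_add,
    smul_smul, smul_smul, mul_assoc, hscale, one_smul]
  simp only [add_zero]

theorem exists_circuit_isBlockEncoding_exp_of_le {H : Matrix (Reg (Fin s)) (Reg (Fin s)) ℂ}
    (hH : H.IsHermitian) {c : ℝ} (hU : IsBlockEncoding c 0 U H) {t : ℝ} (ht : 0 ≤ t) {ε : ℝ}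
    (hε : 0 < ε) (hε1 : ε < 1) {α : ℝ} (hα : 5 / 2 ≤ α) {l : ℕ}
    (hl : 2.8 * c * t + Real.log (1 / ε) ≤ (l + 1 : ℕ)) :
    ∃ V : Circuit 3 a, V.calls = 2 * l + 1 ∧ V.otherGates = 6 * l + 7 ∧
      IsBlockEncoding α (ε / 8) (V.eval U) (NormedSpace.exp ((-(Complex.I * t)) • H)) := by
  have hτ : 0 ≤ c * t := mul_nonneg hU.nonneg ht
  have hlog : 0 ≤ Real.log (1 / ε) := Real.log_nonneg ((one_le_div hε).mpr hε1.le)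
  have herr : (c * t) ^ (2 * (l + 1)) / (2 * (l + 1)).factorial ≤ ε ^ 2 / 10 :=
    pow_div_factorial_le_of_log_le hτ hε l.succ_pos (by rwa [← mul_assoc])
  have hτl : c * t ≤ 1 / 5 * ((2 * (l + 1) : ℕ) + 1) := by
    push_cast at hl ⊢
    linarith
  have hspec : specNorm ((-(Complex.I * t)) • H) ≤ c * t := by
    have h := mul_le_mul_of_nonneg_right hU.specNorm_le ht
    rw [specNorm, map_smul, norm_smul, norm_neg, norm_mul, Complex.norm_I, Complex.norm_real,
      Real.norm_of_nonneg ht, one_mul, mul_comm]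
    rwa [add_zero] at h
  obtain ⟨V, hcalls, hgates, hV⟩ := exists_circuit_smul_zeroBlock_eq_sum hU.unitary hH
    hU.smul_zeroBlock_eq hτ hτl (herr.trans (by nlinarith))
  have hencoding : IsBlockEncoding (5 / 2) (ε / 8) (V.eval U)
      (NormedSpace.exp ((-(Complex.I * t)) • H)) := by
    refine ⟨Circuit.eval_mem_unitaryGroup hU.unitary V, by norm_num, ?_⟩
    rw [hV]
    refine (specNorm_exp_sub_sum_le hspec (by omega) hτl (by norm_num)).trans ?_
    nlinarith
  exact ⟨V.damp _, (Circuit.calls_damp _ V).trans hcalls,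
    (Circuit.otherGates_damp _ V).trans (by rw [hgates]), hencoding.damp hU.unitary hα⟩

theorem exists_circuit_isBlockEncoding_exp {H : Matrix (Reg (Fin s)) (Reg (Fin s)) ℂ}
    (hH : H.IsHermitian) {c : ℝ} (hU : IsBlockEncoding c 0 U H) {t : ℝ} (ht : 0 ≤ t) {ε : ℝ}
    (hε : 0 < ε) (hε1 : ε < 1) {α : ℝ} (hα : 5 / 2 ≤ α) :
    ∃ V : Circuit 3 a, (V.calls : ℤ) = 2 * ⌈2.8 * c * t + Real.log (1 / ε)⌉ - 1 ∧
      (V.otherGates : ℤ) ≤ 7 * (2 * ⌈2.8 * c * t + Real.log (1 / ε)⌉ - 1) ∧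
      IsBlockEncoding α (ε / 8) (V.eval U) (NormedSpace.exp ((-(Complex.I * t)) • H)) := by
  have hlog : 0 < Real.log (1 / ε) := Real.log_pos ((one_lt_div hε).mpr hε1)
  have hpos : 0 < 2.8 * c * t + Real.log (1 / ε) := by linarith [mul_nonneg hU.nonneg ht]
  obtain ⟨l, hl⟩ := Int.eq_succ_of_zero_lt (Int.ceil_pos.mpr hpos)
  obtain ⟨V, hcalls, hgates, hV⟩ := exists_circuit_isBlockEncoding_exp_of_le hH hU ht hε hε1 hα
    (by exact_mod_cast Int.ceil_le.mp hl.le)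
  exact ⟨V, by omega, by omega, hV⟩

theorem OscillatorChain.hamiltonian_isHermitian {N : ℕ} (c : OscillatorChain N) :
    c.hamiltonian.IsHermitian := by
  ext x y
  simp only [hamiltonian, Matrix.conjTranspose_apply, Matrix.neg_apply, Matrix.of_apply, star_neg,
    star_add, apply_ite star, star_star, star_zero]
  rw [add_comm]
  simp only [and_comm]

section Normalized

variable {ι : Type} [Fintype ι] [DecidableEq ι]

theorem norm_normalized {ψ : QState ι} (h : ψ ≠ 0) : ‖normalized ψ‖ = 1 := by
  rw [normalized, norm_smul, Complex.norm_real, norm_inv, norm_norm,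
    inv_mul_cancel₀ (norm_ne_zero_iff.mpr h)]

theorem norm_normalized_sub_self_le (ψ : QState ι) : ‖normalized ψ - ψ‖ ≤ |1 - ‖ψ‖| := by
  rcases eq_or_ne ψ 0 with rfl | h
  · simp [normalized]
  have hsub : normalized ψ - ψ = ((‖ψ‖⁻¹ - 1 : ℝ) : ℂ) • ψ := by
    rw [normalized, Complex.ofReal_sub, Complex.ofReal_one, sub_smul, one_smul]
  rw [hsub, norm_smul, Complex.norm_real, Real.norm_eq_abs, ← abs_norm ψ, ← abs_mul, abs_norm,
    sub_mul, inv_mul_cancel₀ (norm_ne_zero_iff.mpr h), one_mul]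

variable {φ ψ : QState ι} {δ : ℝ}

theorem norm_normalized_sub_le_two_mul (hψ : ‖ψ‖ = 1) (h : ‖φ - ψ‖ ≤ δ) :
    ‖normalized φ - ψ‖ ≤ 2 * δ :=
  calc ‖normalized φ - ψ‖ ≤ ‖normalized φ - φ‖ + ‖φ - ψ‖ := norm_sub_le_norm_sub_add_norm_sub _ _ _
    _ ≤ |‖ψ‖ - ‖φ‖| + ‖φ - ψ‖ := by
      gcongr
      exact hψ ▸ norm_normalized_sub_self_le φ
    _ ≤ ‖φ - ψ‖ + ‖φ - ψ‖ := by
      gcongr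
      exact (abs_norm_sub_norm_le ψ φ).trans_eq (norm_sub_rev ψ φ)
    _ ≤ 2 * δ := by linarith

theorem one_sub_two_mul_le_norm_sq (hψ : ‖ψ‖ = 1) (h : ‖φ - ψ‖ ≤ δ) : 1 - 2 * δ ≤ ‖φ‖ ^ 2 := by
  have hφ : 1 - δ ≤ ‖φ‖ := by linarith [norm_sub_norm_le ψ φ, norm_sub_rev ψ φ]
  nlinarith [sq_nonneg (‖φ‖ - 1)]

end Normalized

theorem natCeil_le_ceil_div {α r : ℝ} (hα : 0 ≤ α) (hr : 0 < r) (hr1 : r ≤ 1) :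
    (⌈α⌉₊ : ℤ) ≤ ⌈|α| / r⌉ := by
  rw [Int.natCast_ceil_eq_ceil hα, abs_of_nonneg hα]
  exact Int.ceil_le_ceil (le_div_self hα hr hr1)

theorem IsBlockEncoding.exists_amplify (hU : U ∈ Matrix.unitaryGroup (Reg (Fin a ⊕ Fin s)) ℂ)
    {b : ℕ} {V : Circuit b a} {W : Matrix (Reg (Fin s)) (Reg (Fin s)) ℂ}
    (hW : W ∈ Matrix.unitaryGroup (Reg (Fin s)) ℂ) {α δ : ℝ}
    (hV : IsBlockEncoding α δ (V.eval U) W) {ψ : QState (Fin s)} (hψ : ψ ≠ 0) (hψ1 : ‖ψ‖ ≤ 1)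
    (G : ℕ) : ∃ (m : ℕ) (θ : ℝ), (m : ℤ) ≤ ⌈|α| / ‖ψ‖⌉ ∧
      (((V.damp θ).amplify m).callCost G : ℤ) ≤ (2 * ⌈|α| / ‖ψ‖⌉ + 1) * (V.callCost G : ℤ) ∧
      (((V.damp θ).amplify m).otherGates : ℤ) ≤
        3 * ((2 * ⌈|α| / ‖ψ‖⌉ + 1) * (V.otherGates + 1)) ∧
      ‖outputState (((V.damp θ).amplify m).eval U) (normalized ψ) - applyOp W (normalized ψ)‖ ≤
        if δ ≤ 1 / 8 then 4 * δ else 16 * δ := by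
  have hm := natCeil_le_ceil_div hV.nonneg (norm_pos_iff.mpr hψ) hψ1
  refine ⟨⌈α⌉₊, dampAngle α, hm, Circuit.callCost_amplify_damp_le G _ V hm,
    Circuit.otherGates_amplify_damp_le _ V hm, ?_⟩
  split_ifs with hδ
  · exact hV.norm_outputState_amplify_sub_le_four_mul hU hW hδ (norm_normalized hψ).le
  · exact hV.norm_outputState_amplify_sub_le_sixteen_mul hU hW (norm_normalized hψ).le

theorem IsBlockEncoding.exists_amplify_close
    (hU : U ∈ Matrix.unitaryGroup (Reg (Fin a ⊕ Fin s)) ℂ)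
    {b : ℕ} {V : Circuit b a} {W : Matrix (Reg (Fin s)) (Reg (Fin s)) ℂ}
    (hW : W ∈ Matrix.unitaryGroup (Reg (Fin s)) ℂ) {α ε : ℝ} (hε1 : ε < 1)
    (hV : IsBlockEncoding α (ε / 8) (V.eval U) W) {ψ : QState (Fin s)} (hψ : ψ ≠ 0)
    (hψ1 : ‖ψ‖ ≤ 1) (G : ℕ) : ∃ (m : ℕ) (θ : ℝ), (m : ℤ) ≤ ⌈|α| / ‖ψ‖⌉ ∧
      let C : Circuit (b + 1) a := (V.damp θ).amplify m
      let out := outputState (C.eval U) (normalized ψ)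
      let target := applyOp W (normalized ψ)
      (C.callCost G : ℤ) ≤ (2 * ⌈|α| / ‖ψ‖⌉ + 1) * (V.callCost G : ℤ) ∧
      (C.otherGates : ℤ) ≤ 3 * ((2 * ⌈|α| / ‖ψ‖⌉ + 1) * (V.otherGates + 1)) ∧
      ‖out - target‖ ≤ ε ∧ 1 - ε ≤ ‖out‖ ^ 2 ∧ ‖normalized out - target‖ ≤ ε := by
  obtain ⟨m, θ, hm, hcost, hgates, herr⟩ := hV.exists_amplify hU hW hψ hψ1 G
  have htarget : ‖applyOp W (normalized ψ)‖ = 1 :=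
    (norm_applyOp_of_mem_unitaryGroup hW _).trans (norm_normalized hψ)
  rw [if_pos (by linarith)] at herr
  have hflag := one_sub_two_mul_le_norm_sq htarget herr
  have hpost := norm_normalized_sub_le_two_mul htarget herr
  have hε := hV.error_nonneg
  exact ⟨m, θ, hm, hcost, hgates, by linarith, by linarith, by linarith⟩

end Simulation

theorem theorem2_general :
    ∃ K : ℕ, ∀ (s a G : ℕ) (H : Matrix (Reg (Fin s)) (Reg (Fin s)) ℂ), H.IsHermitian →
      ∀ (αH : ℝ) (U : Matrix (Reg (Fin a ⊕ Fin s)) (Reg (Fin a ⊕ Fin s)) ℂ),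
      IsBlockEncoding αH 0 U H → ∀ t : ℝ, 0 ≤ t →
      (∀ ε : ℝ, 0 < ε → ε < 1 → ∀ αHS : ℝ, 5 / 2 ≤ αHS →
        ∃ V : Circuit 3 a,
          IsBlockEncoding αHS ε (V.eval U) (NormedSpace.exp ((-(Complex.I * t)) • H)) ∧
          (V.callCost G : ℤ) ≤ (2 * ⌈2.8 * αH * t + Real.log (1 / ε)⌉ - 1) * G ∧
          (V.otherGates : ℤ) ≤ K * (2 * ⌈2.8 * αH * t + Real.log (1 / ε)⌉ - 1) ∧
          ∀ ψ₀ : QState (Fin s), ψ₀ ≠ 0 → ‖ψ₀‖ ≤ 1 →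
            ∃ (m : ℕ) (θ : ℝ), (m : ℤ) ≤ ⌈|αHS| / ‖ψ₀‖⌉ ∧
              let C : Circuit 4 a := (V.damp θ).amplify m
              let out := outputState (C.eval U) (normalized ψ₀)
              let target := applyOp (NormedSpace.exp ((-(Complex.I * t)) • H)) (normalized ψ₀)
              (C.callCost G : ℤ) ≤
                (2 * ⌈|αHS| / ‖ψ₀‖⌉ + 1) *
                  (2 * ⌈2.8 * αH * t + Real.log (1 / ε)⌉ - 1) * G ∧
              (C.otherGates : ℤ) ≤
                K * ((2 * ⌈|αHS| / ‖ψ₀‖⌉ + 1) *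
                  (2 * ⌈2.8 * αH * t + Real.log (1 / ε)⌉ - 1)) ∧
              ‖out - target‖ ≤ ε ∧
              1 - ε ≤ ‖out‖ ^ 2 ∧
              ‖normalized out - target‖ ≤ ε) ∧
      (∀ (b : ℕ) (V : Circuit b a) (αHS δ : ℝ),
        IsBlockEncoding αHS δ (V.eval U) (NormedSpace.exp ((-(Complex.I * t)) • H)) →
        ∀ ψ₀ : QState (Fin s), ψ₀ ≠ 0 → ‖ψ₀‖ ≤ 1 →
          ∃ (m : ℕ) (θ : ℝ), (m : ℤ) ≤ ⌈|αHS| / ‖ψ₀‖⌉ ∧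
            let C : Circuit (b + 1) a := (V.damp θ).amplify m
            let out := outputState (C.eval U) (normalized ψ₀)
            let target := applyOp (NormedSpace.exp ((-(Complex.I * t)) • H)) (normalized ψ₀)
            (C.callCost G : ℤ) ≤ (2 * ⌈|αHS| / ‖ψ₀‖⌉ + 1) * (V.callCost G : ℤ) ∧
            (C.otherGates : ℤ) ≤ K * ((2 * ⌈|αHS| / ‖ψ₀‖⌉ + 1) * (V.otherGates + 1)) ∧
            ‖out - target‖ ≤ K * δ) := by
  refine ⟨24, fun s a G H hH αH U hU t ht => ?_⟩
  have hW := exp_neg_I_smul_mem_unitaryGroup hH t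
  refine ⟨fun ε hε hε1 αHS hαHS => ?_, fun b V αHS δ hV ψ₀ hψ hψ1 => ?_⟩
  · obtain ⟨V, hcalls, hgates, hV⟩ := exists_circuit_isBlockEncoding_exp hH hU ht hε hε1 hαHS
    have hcost : (V.callCost G : ℤ) = (2 * ⌈2.8 * αH * t + Real.log (1 / ε)⌉ - 1) * G := by
      rw [Circuit.callCost, Nat.cast_mul, hcalls]
    refine ⟨V, ⟨hV.unitary, hV.nonneg, hV.error_le.trans (by linarith)⟩, hcost.le, by omega,
      fun ψ₀ hψ hψ1 => ?_⟩
    obtain ⟨m, θ, hm, hcost', hgates', hclose⟩ :=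
      hV.exists_amplify_close hU.unitary hW hε1 hψ hψ1 G
    refine ⟨m, θ, hm, by rwa [hcost, ← mul_assoc] at hcost', hgates'.trans ?_, hclose⟩
    rw [mul_left_comm, mul_left_comm ((24 : ℕ) : ℤ)]
    exact mul_le_mul_of_nonneg_left (by omega) (by positivity)
  · obtain ⟨m, θ, hm, hcost, hgates, herr⟩ := hV.exists_amplify hU.unitary hW hψ hψ1 G
    refine ⟨m, θ, hm, hcost, hgates.trans ?_, herr.trans ?_⟩
    · exact mul_le_mul_of_nonneg_right (by norm_num) (by positivity)
    · have hδ := hV.error_nonneg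
      push_cast
      split_ifs <;> linarith

theorem theorem2 :
    ∃ K : ℕ, ∀ (N : ℕ) (chain : OscillatorChain N) (a : ℕ) (αH : ℝ)
      (u : List (LocalGate (Fin a ⊕ Fin (OscillatorChain.indexQubits N + 1)))),
      IsBlockEncoding αH 0 (evalLocal u) chain.hamiltonian →
      ∀ t : ℝ, 0 ≤ t →
      -- a block encoding of the evolution operator, and its amplification
      (∀ ε : ℝ, 0 < ε → ε < 1 → ∀ αHS : ℝ, 4 ≤ αHS →
        ∃ V : Circuit 3 a,
          IsBlockEncoding αHS ε (V.eval (evalLocal u)) (chain.evolution t) ∧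
          (V.callCost u.length : ℤ) ≤ (2 * ⌈2.8 * αH * t + Real.log (1 / ε)⌉ - 1) * u.length ∧
          (V.otherGates : ℤ) ≤ K * (2 * ⌈2.8 * αH * t + Real.log (1 / ε)⌉ - 1) ∧
          ∀ ψ₀ : QState (Fin (OscillatorChain.indexQubits N + 1)), ψ₀ ≠ 0 → ‖ψ₀‖ ≤ 1 →
            ∃ (m : ℕ) (θ : ℝ), (m : ℤ) ≤ ⌈|αHS| / ‖ψ₀‖⌉ ∧
              let C : Circuit 4 a := (V.damp θ).amplify m
              let out := outputState (C.eval (evalLocal u)) (normalized ψ₀)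
              let target := applyOp (chain.evolution t) (normalized ψ₀)
              (C.callCost u.length : ℤ) ≤
                (2 * ⌈|αHS| / ‖ψ₀‖⌉ + 1) *
                  (2 * ⌈2.8 * αH * t + Real.log (1 / ε)⌉ - 1) * u.length ∧
              (C.otherGates : ℤ) ≤
                K * ((2 * ⌈|αHS| / ‖ψ₀‖⌉ + 1) *
                  (2 * ⌈2.8 * αH * t + Real.log (1 / ε)⌉ - 1)) ∧
              ‖out - target‖ ≤ ε ∧
              1 - ε ≤ ‖out‖ ^ 2 ∧
              ‖normalized out - target‖ ≤ ε) ∧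
      -- robust amplification of an arbitrary block encoding of the evolution operator
      (∀ (b : ℕ) (V : Circuit b a) (αHS δ : ℝ),
        IsBlockEncoding αHS δ (V.eval (evalLocal u)) (chain.evolution t) →
        ∀ ψ₀ : QState (Fin (OscillatorChain.indexQubits N + 1)), ψ₀ ≠ 0 → ‖ψ₀‖ ≤ 1 →
          ∃ (m : ℕ) (θ : ℝ), (m : ℤ) ≤ ⌈|αHS| / ‖ψ₀‖⌉ ∧
            let C : Circuit (b + 1) a := (V.damp θ).amplify m
            let out := outputState (C.eval (evalLocal u)) (normalized ψ₀)
            let target := applyOp (chain.evolution t) (normalized ψ₀)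
            (C.callCost u.length : ℤ) ≤
              (2 * ⌈|αHS| / ‖ψ₀‖⌉ + 1) * (V.callCost u.length : ℤ) ∧
            (C.otherGates : ℤ) ≤ K * ((2 * ⌈|αHS| / ‖ψ₀‖⌉ + 1) * (V.otherGates + 1)) ∧
            ‖out - target‖ ≤ K * δ) := by
  obtain ⟨K, hK⟩ := theorem2_general
  refine ⟨K, fun N chain a αH u hu t ht => ?_⟩
  have h := hK _ a u.length _ chain.hamiltonian_isHermitian αH _ hu t ht
  exact ⟨fun ε hε hε1 αHS hαHS => h.1 ε hε hε1 αHS (by linarith), h.2⟩
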